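/- There is a constant $C$ such that for every integer $n \ge 0$, up to congruence, there are at most $C n^3$ convex polygons $P$ in the Euclidean plane (with non-empty interior) whose doubly covered polygon can be glued edge to edge from at most $n$ unit squares. Here the doubly covered polygon of $P$ is the surface obtained from two copies of $P$ by identifying their boundaries pointwise. An edge-to-edge gluing of $m$ unit squares pairs up the $4m$ sides of the squares, each side with a different side, and identifies the two sides of each pair along their full length by an isometry (the squares may be folded in space). The doubly covered polygon of $P$ can be glued from $m$ squares if the surface of some such gluing, with its intrinsic metric, is isometric to the doubly covered polygon with its intrinsic metric. In particular, $O(n^3)$ doubly covered convex polygons can be glued from $n$ squares. -/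

import Mathlib

open scoped ENNReal

/-- The Euclidean plane. -/
abbrev Plane := EuclideanSpace ℝ (Fin 2)

/-- A gluing diagram: a family of convex plane pieces, and a relation telling which points of the
pieces are glued to each other: `glue i a j b` says that the point `a` of the piece `i` is glued to
the point `b` of the piece `j` (the equivalence relation generated by it is meant). -/
structure GluingDiagram where
  ι : Type
  region : ι → Set Plane
  convex_region : ∀ i, Convex ℝ (region i)
  glue : ι → Plane → ι → Plane → Prop

namespace GluingDiagram

/-- A point of the disjoint union of the pieces of a gluing diagram. -/
@[ext]
structure Point (D : GluingDiagram) where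
  piece : D.ι
  pos : Plane
  mem : pos ∈ D.region piece

/-- `D.Path x y r`: one can walk from `x` to `y` along finitely many straight segments, each of
them inside one (convex) piece, and jumps between glued points; the total length is `r`. -/
inductive Path (D : GluingDiagram) : D.Point → D.Point → ℝ≥0∞ → Prop
  | segment (i : D.ι) (a b : Plane) (ha : a ∈ D.region i) (hb : b ∈ D.region i) :
      Path D ⟨i, a, ha⟩ ⟨i, b, hb⟩ (edist a b)
  | jump (x y : D.Point) (h : D.glue x.piece x.pos y.piece y.pos) : Path D x y 0
  | symm {x y : D.Point} {r : ℝ≥0∞} (h : Path D x y r) : Path D y x r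
  | trans {x y z : D.Point} {r s : ℝ≥0∞} (h : Path D x y r) (h' : Path D y z s) :
      Path D x z (r + s)

/-- The intrinsic (pseudo-)distance of the glued surface: the infimum of the lengths of the paths
from one point to the other (`⊤` if there is none). -/
noncomputable instance (D : GluingDiagram) : PseudoEMetricSpace D.Point where
  edist x y := ⨅ (r : ℝ≥0∞) (_ : D.Path x y r), r
  edist_self x := by
    refine le_antisymm (iInf₂_le_of_le 0 ?_ le_rfl) bot_le
    have h := Path.segment (D := D) x.piece x.pos x.pos x.mem x.mem
    rw [edist_self] at h
    exact h
  edist_comm x y :=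
    le_antisymm (le_iInf₂ fun r hr => iInf₂_le r hr.symm) (le_iInf₂ fun r hr => iInf₂_le r hr.symm)
  edist_triangle x y z := by
    refine ENNReal.le_of_forall_pos_le_add fun ε hε hlt => ?_
    have hne := ENNReal.add_lt_top.1 hlt
    have hε2 : ((ε : ℝ≥0∞) / 2) ≠ 0 := by
      simpa using hε.ne'
    have h1 := ENNReal.lt_add_right hne.1.ne hε2
    have h2 := ENNReal.lt_add_right hne.2.ne hε2
    simp only [iInf_lt_iff] at h1 h2
    obtain ⟨r, hr, hr'⟩ := h1
    obtain ⟨s, hs, hs'⟩ := h2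
    refine (iInf₂_le (r + s) (hr.trans hs)).trans ((add_le_add hr'.le hs'.le).trans (le_of_eq ?_))
    rw [add_add_add_comm, ENNReal.add_halves]

/-- The glued surface as a metric space: points at intrinsic distance `0` are identified. -/
abbrev Surface (D : GluingDiagram) : Type := SeparationQuotient D.Point

end GluingDiagram

/-! ### Edge-to-edge gluings of unit squares -/

/-- The closed unit square. -/
def unitSquare : Set Plane := {x | ∀ k, x k ∈ Set.Icc (0 : ℝ) 1}

theorem convex_unitSquare : Convex ℝ unitSquare := by
  intro x hx y hy a b ha hb hab k
  simpa using convex_Icc (0 : ℝ) 1 (hx k) (hy k) ha hb hab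

/-- The four edges of the unit square, numbered and parametrized counterclockwise from the
origin. -/
noncomputable def squareEdge (k : Fin 4) (t : ℝ) : Plane :=
  match k with
  | 0 => !₂[t, 0]
  | 1 => !₂[1, t]
  | 2 => !₂[1 - t, 1]
  | 3 => !₂[0, 1 - t]

/-- A combinatorial edge-to-edge gluing of `n` unit squares: every edge (square `e.1`, side `e.2`)
is glued, along its full length, onto another edge `partner e`. With the counterclockwise
parametrizations the point with parameter `t` is glued to the point with parameter `1 - t` on the
partner edge if `flip e`, and to the one with parameter `t` otherwise. -/
structure SquareGluing (n : ℕ) where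
  partner : Fin n × Fin 4 → Fin n × Fin 4
  partner_partner : ∀ e, partner (partner e) = e
  partner_ne : ∀ e, partner e ≠ e
  flip : Fin n × Fin 4 → Bool
  flip_partner : ∀ e, flip (partner e) = flip e

/-- The gluing diagram of an edge-to-edge gluing of `n` unit squares. -/
noncomputable def SquareGluing.diagram {n : ℕ} (G : SquareGluing n) : GluingDiagram where
  ι := Fin n
  region := fun _ => unitSquare
  convex_region := fun _ => convex_unitSquare
  glue := fun i a j b => ∃ (k l : Fin 4), G.partner (i, k) = (j, l) ∧
    ∃ t ∈ Set.Icc (0 : ℝ) 1, a = squareEdge k t ∧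
      b = squareEdge l (if G.flip (i, k) then 1 - t else t)

/-! ### Doubly covered convex polygons -/

/-- A (non-degenerate, filled) convex polygon in the plane. -/
structure ConvexPolygon where
  carrier : Set Plane
  exists_vertices : ∃ V : Finset Plane, carrier = convexHull ℝ (V : Set Plane)
  nonempty_interior : (interior carrier).Nonempty

namespace ConvexPolygon

theorem convex (P : ConvexPolygon) : Convex ℝ P.carrier := by
  obtain ⟨V, hV⟩ := P.exists_vertices
  rw [hV]
  exact convex_convexHull ℝ _

/-- The doubly covered polygon: two copies of the polygon, glued along their boundaries by the
identity. -/
def doubleDiagram (P : ConvexPolygon) : GluingDiagram where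
  ι := Bool
  region := fun _ => P.carrier
  convex_region := fun _ => P.convex
  glue := fun _ a _ b => a = b ∧ a ∈ frontier P.carrier

/-- The doubly covered polygon `P` can be glued edge to edge from `n` unit squares: the surface
of some such gluing is isometric, in its intrinsic metric, to the doubly covered polygon. -/
def GluableFrom (P : ConvexPolygon) (n : ℕ) : Prop :=
  ∃ G : SquareGluing n, Nonempty (G.diagram.Surface ≃ᵢ P.doubleDiagram.Surface)

/-- Congruence of convex polygons. -/
def congruence : Setoid ConvexPolygon where
  r P Q := ∃ e : Plane ≃ᵢ Plane, e '' P.carrier = Q.carrier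
  iseqv :=
    { refl := fun P => ⟨IsometryEquiv.refl _, Set.image_id _⟩
      symm := by
        rintro P Q ⟨e, h⟩
        refine ⟨e.symm, ?_⟩
        rw [← h, Set.image_image]
        simp
      trans := by
        rintro P Q R ⟨e, h⟩ ⟨f, h'⟩
        refine ⟨e.trans f, ?_⟩
        rw [← h', ← h, ← Set.image_comp]
        rfl }

/-- The congruence classes of the convex polygons `P` whose double can be glued edge to edge from
at most `n` unit squares. -/
def gluableClasses (n : ℕ) : Set (Quotient congruence) :=
  {c | ∃ P : ConvexPolygon, Quotient.mk congruence P = c ∧ ∃ m ≤ n, P.GluableFrom m}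

end ConvexPolygon

/-! Away from the finitely many corner points, a surface glued from squares has flat charts in which
the squares sit in the plane by isometries of the integer lattice (`SquareGluing.exists_chart`). If
the surface is the double of `P`, each of the two sheets of `P` can be developed along segments that
avoid the corners, and the result is well defined up to the lattice group: `τ` for one sheet, `κ`
for the other. At an edge `e` of `P` the sheets agree on the edge and differ inside. In a common
chart they are therefore mirror images, so `κ = w ∘ τ ∘ r_e` with `r_e` the reflection in `e` and
`w` in the lattice group (`exists_developments`). Comparing two edges eliminates `κ`: once `P` has
been moved by `τ`, all products `r_e ∘ r_e'` preserve the lattice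
(`ConvexPolygon.GluableFrom.exists_congruent`).

This is very rigid. The rotation part of such a product is an integral rotation, so any two edges
meet at a multiple of 45 degrees; its centre, the meeting point of the two edge lines, is
half-integral. In a frame along a primitive lattice vector `(p, q)` parallel to an edge, rescaled by
a quarter of its length, `P` becomes an octagon with integer support numbers
(`ConvexPolygon.exists_isIntOctagon`), the only trace of the frame being the integer `N = p² + q²`.

For the count, a turn by 45 degrees if necessary gives a bounding box `D × ω`, `ω ≤ D`, of which the
octagon occupies at least a hundredth (`le_volume_octagon`). The area of `P` is at most the number
of squares, which yields `j * ω * D ≤ K` with `K = 3200 n` and `j` equal to `N` or `2 N`. The four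
corner cuts are at most `ω`. For fixed `j`, with `M = K / j`, there are about `∑_{ω ≤ √M} (M / ω)
ω⁴`, hence `O(M³)`, choices, and `∑ j⁻³` converges, so summing over all scales still gives `O(n³)`
(`card_octagonData_le_tsum`). -/

open MeasureTheory

/-! ### The intrinsic distance of a glued surface -/

namespace GluingDiagram

variable {D : GluingDiagram}

theorem edist_le_of_path {x y : D.Point} {r : ℝ≥0∞} (h : D.Path x y r) : edist x y ≤ r :=
  iInf₂_le r h

theorem exists_path_of_edist_lt {x y : D.Point} {r : ℝ≥0∞} (h : edist x y < r) :
    ∃ s < r, D.Path x y s := by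
  have h' : (⨅ (r : ℝ≥0∞) (_ : D.Path x y r), r) < r := h
  simp only [iInf_lt_iff] at h'
  obtain ⟨s, hs, hlt⟩ := h'
  exact ⟨s, hlt, hs⟩

/-- A map that is `1`-Lipschitz on every piece and respects the gluing is `1`-Lipschitz for the
intrinsic distance. -/
theorem edist_map_le {X : Type*} [PseudoEMetricSpace X] (F : D.Point → X)
    (hseg : ∀ i a b ha hb, edist (F ⟨i, a, ha⟩) (F ⟨i, b, hb⟩) ≤ edist a b)
    (hglue : ∀ x y : D.Point, D.glue x.piece x.pos y.piece y.pos → edist (F x) (F y) = 0)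
    (x y : D.Point) : edist (F x) (F y) ≤ edist x y := by
  refine le_iInf₂ fun r hr => ?_
  induction hr with
  | segment i a b ha hb => exact hseg i a b ha hb
  | jump x y h => exact (hglue x y h).le
  | symm _ ih => rwa [edist_comm]
  | trans _ _ ih ih' => exact (edist_triangle _ _ _).trans (add_le_add ih ih')

theorem edist_mk_le (i : D.ι) {a b : Plane} (ha : a ∈ D.region i) (hb : b ∈ D.region i) :
    edist (⟨i, a, ha⟩ : D.Point) ⟨i, b, hb⟩ ≤ edist a b :=
  edist_le_of_path (Path.segment i a b ha hb)

theorem edist_eq_zero_of_glue {x y : D.Point} (h : D.glue x.piece x.pos y.piece y.pos) :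
    edist x y = 0 :=
  le_antisymm (edist_le_of_path (Path.jump x y h)) bot_le

end GluingDiagram

/-! ### The two sheets of a doubled polygon -/

namespace ConvexPolygon

theorem isCompact (P : ConvexPolygon) : IsCompact P.carrier := by
  obtain ⟨V, hV⟩ := P.exists_vertices
  rw [hV]
  exact V.finite_toSet.isCompact_convexHull ℝ

theorem isClosed (P : ConvexPolygon) : IsClosed P.carrier := P.isCompact.isClosed

theorem frontier_subset (P : ConvexPolygon) : frontier P.carrier ⊆ P.carrier :=
  P.isClosed.frontier_subset

/-- Folding the two sheets onto each other is a 1-Lipschitz map to the plane, so the second sheet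
offers no shortcuts. -/
theorem edist_double (P : ConvexPolygon) (s : Bool) {a b : Plane} (ha : a ∈ P.carrier)
    (hb : b ∈ P.carrier) :
    edist (⟨s, a, ha⟩ : P.doubleDiagram.Point) ⟨s, b, hb⟩ = edist a b := by
  refine le_antisymm (GluingDiagram.edist_mk_le (D := P.doubleDiagram) s ha hb) ?_
  exact GluingDiagram.edist_map_le (D := P.doubleDiagram) (fun x => x.pos)
    (fun _ _ _ _ _ => le_rfl) (fun x y h => by rw [h.1, edist_self]) ⟨s, a, ha⟩ ⟨s, b, hb⟩

/-- The signed distance to the frontier, positive on one sheet and negative on the other, is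
compatible with the gluing and 1-Lipschitz, and it separates the two copies of an interior point. -/
theorem edist_double_ne_zero (P : ConvexPolygon) {a : Plane} (ha : a ∈ P.carrier)
    (hf : a ∉ frontier P.carrier) (hne : (frontier P.carrier).Nonempty) :
    edist (⟨true, a, ha⟩ : P.doubleDiagram.Point) ⟨false, a, ha⟩ ≠ 0 := by
  let d : Plane → ℝ := fun x => Metric.infDist x (frontier P.carrier)
  have hd : LipschitzWith 1 d := Metric.lipschitz_infDist_pt _
  have hd' : LipschitzWith 1 (fun x => -d x) := hd.neg
  let F : P.doubleDiagram.Point → ℝ := fun x => cond (show Bool from x.piece) (d x.pos) (-d x.pos)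
  have key := GluingDiagram.edist_map_le (D := P.doubleDiagram) F ?_ ?_ ⟨true, a, ha⟩ ⟨false, a, ha⟩
  · intro h0
    rw [h0] at key
    have h1 : F ⟨true, a, ha⟩ = F ⟨false, a, ha⟩ := edist_eq_zero.1 (le_antisymm key bot_le)
    have h2 : d a = -d a := h1
    have h3 : 0 < d a := (isClosed_frontier.notMem_iff_infDist_pos hne).1 hf
    linarith
  · intro i a b ha hb
    have e1 := hd.edist_le_mul a b
    have e2 := hd'.edist_le_mul a b
    simp only [ENNReal.coe_one, one_mul] at e1 e2
    cases i
    · exact e2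
    · exact e1
  · rintro ⟨i, x, hx⟩ ⟨j, y, hy⟩ ⟨h1, h2⟩
    obtain rfl : x = y := h1
    have h3 : d x = 0 := Metric.infDist_zero_of_mem h2
    have : ∀ i, F ⟨i, x, hx⟩ = 0 := by
      intro i
      cases i
      · exact neg_eq_zero.2 h3
      · exact h3
    exact edist_eq_zero.2 ((this i).trans (this j).symm)

/-- The two sheets of a surface isometric to the double of `P`. -/
theorem exists_sheets (P : ConvexPolygon) {X : Type*} [EMetricSpace X]
    (f : X ≃ᵢ P.doubleDiagram.Surface) :
    ∃ up low : Plane → X,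
      (∀ x ∈ P.carrier, ∀ y ∈ P.carrier, edist (up x) (up y) = edist x y) ∧
      (∀ x ∈ P.carrier, ∀ y ∈ P.carrier, edist (low x) (low y) = edist x y) ∧
      (∀ x ∈ frontier P.carrier, up x = low x) ∧
      (∀ x ∈ interior P.carrier, up x ≠ low x) := by
  classical
  obtain ⟨o, ho⟩ := P.nonempty_interior
  have hoP := interior_subset ho
  -- Outside the polygon the value is arbitrary; an interior point supplies one.
  let sheet : Bool → Plane → X := fun s x =>
    if h : x ∈ P.carrier then f.symm (SeparationQuotient.mk ⟨s, x, h⟩)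
    else f.symm (SeparationQuotient.mk ⟨s, o, hoP⟩)
  have hs : ∀ s x (h : x ∈ P.carrier), sheet s x = f.symm (SeparationQuotient.mk ⟨s, x, h⟩) :=
    fun s x h => dif_pos h
  have hiso : ∀ s, ∀ x ∈ P.carrier, ∀ y ∈ P.carrier, edist (sheet s x) (sheet s y) = edist x y := by
    intro s x hx y hy
    rw [hs s x hx, hs s y hy, f.symm.edist_eq, SeparationQuotient.edist_mk, P.edist_double s hx hy]
  have hfr : (frontier P.carrier).Nonempty := by
    refine nonempty_frontier_iff.2 ⟨⟨o, hoP⟩, fun h => ?_⟩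
    have := P.isCompact
    rw [h] at this
    exact noncompact_univ Plane this
  refine ⟨sheet true, sheet false, hiso true, hiso false, fun x hx => ?_, fun x hx h => ?_⟩
  · have hxP := P.frontier_subset hx
    rw [hs _ x hxP, hs _ x hxP]
    congr 1
    rw [← edist_eq_zero, SeparationQuotient.edist_mk]
    exact GluingDiagram.edist_eq_zero_of_glue ⟨rfl, hx⟩
  · have hxP := interior_subset hx
    rw [hs _ x hxP, hs _ x hxP, ← edist_eq_zero, f.symm.edist_eq, SeparationQuotient.edist_mk] at h
    exact P.edist_double_ne_zero hxP (fun h => h.2 hx) hfr h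

end ConvexPolygon

/-! ### Area of a glued polygon -/

theorem volume_unitSquare : volume unitSquare = 1 := by
  have h : unitSquare = WithLp.ofLp ⁻¹' (Set.Icc (0 : Fin 2 → ℝ) 1) := by
    ext x
    simp [unitSquare, Set.mem_Icc, Pi.le_def, forall_and]
  rw [h, (PiLp.volume_preserving_ofLp (Fin 2)).measure_preimage measurableSet_Icc.nullMeasurableSet,
    Real.volume_Icc_pi]
  simp

namespace ConvexPolygon

open Measure in
/-- The area of a polygon is at most the number of squares its double is glued from. -/
theorem volume_carrier_le (P : ConvexPolygon) {m : ℕ} (h : P.GluableFrom m) :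
    volume P.carrier ≤ m := by
  obtain ⟨G, ⟨f⟩⟩ := h
  obtain ⟨up, -, hup, -⟩ := P.exists_sheets f
  let : MeasurableSpace G.diagram.Surface := borel _
  have : BorelSpace G.diagram.Surface := ⟨rfl⟩
  have hg : Isometry (fun x : P.carrier => up x) := fun x y => hup x x.2 y y.2
  -- Hausdorff measure makes sense on the surface, is preserved by the sheet and is not increased by
  -- the cell maps. Only one of the two sheets is measured; the lost factor 2 is harmless.
  have h1 : μH[(2 : ℕ)] P.carrier = μH[(2 : ℕ)] (Set.range fun x : P.carrier => up x) := by
    rw [← Set.image_univ, hg.hausdorffMeasure_image (by simp),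
      ← (isometry_subtype_coe (s := P.carrier)).hausdorffMeasure_image (by simp)]
    simp
  let c : Fin m → unitSquare → G.diagram.Surface :=
    fun i a => SeparationQuotient.mk ⟨i, a.1, a.2⟩
  have hc : ∀ i, LipschitzWith 1 (c i) := by
    intro i a b
    rw [ENNReal.coe_one, one_mul]
    exact (GluingDiagram.edist_mk_le (D := G.diagram) i a.2 b.2)
  have h2 : (Set.range fun x : P.carrier => up x) ⊆ ⋃ i, Set.range (c i) := by
    rintro s -
    obtain ⟨⟨i, a, ha⟩, rfl⟩ := SeparationQuotient.surjective_mk s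
    exact Set.mem_iUnion.2 ⟨i, ⟨a, ha⟩, rfl⟩
  have h3 : μH[(2 : ℕ)] P.carrier ≤ m * μH[(2 : ℕ)] unitSquare := by
    rw [h1]
    refine (measure_mono h2).trans ((measure_iUnion_fintype_le _ _).trans ?_)
    refine (Finset.sum_le_card_nsmul _ _ (μH[(2 : ℕ)] unitSquare) fun i _ => ?_).trans ?_
    · rw [← Set.image_univ]
      refine ((hc i).hausdorffMeasure_image_le (by simp) _).trans ?_
      rw [← (isometry_subtype_coe (s := unitSquare)).hausdorffMeasure_image (by simp)]
      simp
    · simp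
  -- Area is a constant multiple of planar Hausdorff measure, so the comparison carries over without
  -- knowing the constant.
  have hv := isAddLeftInvariant_eq_smul (volume : Measure Plane) μH[(2 : ℕ)]
  calc volume P.carrier ≤ m * volume unitSquare := by
        rw [hv]
        simp only [Measure.smul_apply, ENNReal.smul_def, smul_eq_mul]
        rw [mul_left_comm]
        gcongr
    _ = m := by rw [volume_unitSquare, mul_one]

end ConvexPolygon

/-! ### The group of the square lattice -/

/-- The lattice of the integer points of the plane. -/
def intLattice : Set Plane := {z | ∀ k, ∃ m : ℤ, z k = m}

theorem intLattice_iff {z : Plane} : z ∈ intLattice ↔ (∃ m : ℤ, z 0 = m) ∧ ∃ m : ℤ, z 1 = m :=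
  Fin.forall_fin_two

/-- The isometries of the plane that preserve the integer lattice. -/
def latticeGroup : Subgroup (Plane ≃ᵃⁱ[ℝ] Plane) where
  carrier := {w | ∀ z, w z ∈ intLattice ↔ z ∈ intLattice}
  mul_mem' := fun {v w} hv hw z => (hv (w z)).trans (hw z)
  one_mem' := fun _ => Iff.rfl
  inv_mem' := fun {w} hw z => by
    have h := hw (w⁻¹ z)
    rw [show w (w⁻¹ z) = z from w.apply_symm_apply z] at h
    exact h.symm

theorem plane_dist_sq (x y : Plane) : dist x y ^ 2 = (x 0 - y 0) ^ 2 + (x 1 - y 1) ^ 2 := by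
  rw [EuclideanSpace.dist_eq, Real.sq_sqrt (by positivity), Fin.sum_univ_two, Real.dist_eq,
    Real.dist_eq, sq_abs, sq_abs]

theorem isometry_of_sq {f : Plane → Plane}
    (h : ∀ x y, (f x 0 - f y 0) ^ 2 + (f x 1 - f y 1) ^ 2 = (x 0 - y 0) ^ 2 + (x 1 - y 1) ^ 2) :
    Isometry f := by
  refine Isometry.of_dist_eq fun x y => ?_
  have h1 : dist (f x) (f y) ^ 2 = dist x y ^ 2 := by rw [plane_dist_sq, plane_dist_sq, h]
  exact (sq_eq_sq₀ dist_nonneg dist_nonneg).1 h1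

theorem plane_ext {x y : Plane} (h0 : x 0 = y 0) (h1 : x 1 = y 1) : x = y := by
  ext k
  fin_cases k
  · exact h0
  · exact h1

/-- An involutive isometry of the plane as an affine isometry. -/
noncomputable def affineIsometryOfInvolutive (f : Plane → Plane) (hf : Isometry f)
    (hi : ∀ x, f (f x) = x) : Plane ≃ᵃⁱ[ℝ] Plane :=
  (IsometryEquiv.mk' f f hi hf).toRealAffineIsometryEquiv

theorem affineIsometryOfInvolutive_apply (f : Plane → Plane) (hf : Isometry f)
    (hi : ∀ x, f (f x) = x) (x : Plane) : affineIsometryOfInvolutive f hf hi x = f x := by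
  rw [affineIsometryOfInvolutive, IsometryEquiv.coeFn_toRealAffineIsometryEquiv]
  rfl

theorem affineIsometryOfInvolutive_mem (f : Plane → Plane) (hf : Isometry f)
    (hi : ∀ x, f (f x) = x) (h : ∀ x ∈ intLattice, f x ∈ intLattice) :
    affineIsometryOfInvolutive f hf hi ∈ latticeGroup := by
  intro z
  rw [affineIsometryOfInvolutive_apply]
  refine ⟨fun hz => ?_, h z⟩
  rw [← hi z]
  exact h _ hz

/-- Coordinates in which the edge `k` of the unit square is the segment from `(0, 0)` to `(0, 1)`
and the square is to the right of it. -/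
noncomputable def edgeCoord (k : Fin 4) (x : Plane) : Plane :=
  match k with
  | 0 => !₂[x 1, x 0]
  | 1 => !₂[1 - x 0, x 1]
  | 2 => !₂[1 - x 1, 1 - x 0]
  | 3 => !₂[x 0, 1 - x 1]

theorem edgeCoord_edgeCoord (k : Fin 4) (x : Plane) : edgeCoord k (edgeCoord k x) = x := by
  fin_cases k <;> refine plane_ext ?_ ?_ <;> simp [edgeCoord]

theorem isometry_edgeCoord (k : Fin 4) : Isometry (edgeCoord k) := by
  refine isometry_of_sq fun x y => ?_
  fin_cases k <;> simp [edgeCoord] <;> ring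

theorem edgeCoord_mem_intLattice (k : Fin 4) {x : Plane} (hx : x ∈ intLattice) :
    edgeCoord k x ∈ intLattice := by
  rw [intLattice_iff] at hx ⊢
  obtain ⟨⟨a, ha⟩, b, hb⟩ := hx
  fin_cases k <;> simp only [edgeCoord]
  · exact ⟨⟨b, by simpa⟩, a, by simpa⟩
  · exact ⟨⟨1 - a, by simp [ha]⟩, b, by simpa⟩
  · exact ⟨⟨1 - b, by simp [hb]⟩, 1 - a, by simp [ha]⟩
  · exact ⟨⟨a, by simpa⟩, 1 - b, by simp [hb]⟩

/-- The reflection in the first axis coordinate, followed by a flip of the unit interval of the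
other axis if `b`. -/
noncomputable def mirrorCoord (b : Bool) (x : Plane) : Plane :=
  !₂[-x 0, if b then 1 - x 1 else x 1]

theorem mirrorCoord_mirrorCoord (b : Bool) (x : Plane) :
    mirrorCoord b (mirrorCoord b x) = x := by
  cases b <;> refine plane_ext ?_ ?_ <;> simp [mirrorCoord]

theorem isometry_mirrorCoord (b : Bool) : Isometry (mirrorCoord b) := by
  refine isometry_of_sq fun x y => ?_
  cases b <;> simp [mirrorCoord] <;> ring

theorem mirrorCoord_mem_intLattice (b : Bool) {x : Plane} (hx : x ∈ intLattice) :
    mirrorCoord b x ∈ intLattice := by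
  rw [intLattice_iff] at hx ⊢
  obtain ⟨⟨a, ha⟩, c, hc⟩ := hx
  cases b
  · exact ⟨⟨-a, by simp [mirrorCoord, ha]⟩, c, by simp [mirrorCoord, hc]⟩
  · exact ⟨⟨-a, by simp [mirrorCoord, ha]⟩, 1 - c, by simp [mirrorCoord, hc]⟩

noncomputable def edgeIso (k : Fin 4) : Plane ≃ᵃⁱ[ℝ] Plane :=
  affineIsometryOfInvolutive (edgeCoord k) (isometry_edgeCoord k) (edgeCoord_edgeCoord k)

noncomputable def mirrorIso (b : Bool) : Plane ≃ᵃⁱ[ℝ] Plane :=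
  affineIsometryOfInvolutive (mirrorCoord b) (isometry_mirrorCoord b) (mirrorCoord_mirrorCoord b)

/-- The finitely many isometries by which unit squares are placed in charts of a glued surface. -/
def placements : Set (Plane ≃ᵃⁱ[ℝ] Plane) :=
  Set.range edgeIso ∪ Set.range fun p : Bool × Fin 4 => mirrorIso p.1 * edgeIso p.2

theorem finite_placements : placements.Finite := (Set.finite_range _).union (Set.finite_range _)

theorem placements_subset : placements ⊆ latticeGroup := by
  have h1 : ∀ k, edgeIso k ∈ latticeGroup := fun k =>
    affineIsometryOfInvolutive_mem _ _ _ fun x hx => edgeCoord_mem_intLattice k hx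
  have h2 : ∀ b, mirrorIso b ∈ latticeGroup := fun b =>
    affineIsometryOfInvolutive_mem _ _ _ fun x hx => mirrorCoord_mem_intLattice b hx
  rintro _ (⟨k, rfl⟩ | ⟨p, rfl⟩)
  · exact h1 k
  · exact latticeGroup.mul_mem (h2 _) (h1 _)

/-! ### Charts of glued squares -/

theorem edgeCoord_bounds (k : Fin 4) {a : Plane} (ha : a ∈ unitSquare) :
    0 ≤ edgeCoord k a 0 ∧ edgeCoord k a 0 ≤ 1 ∧ 0 ≤ edgeCoord k a 1 ∧ edgeCoord k a 1 ≤ 1 := by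
  have h0 := ha 0
  have h1 := ha 1
  simp only [Set.mem_Icc] at h0 h1
  fin_cases k <;> simp [edgeCoord] <;> grind

theorem edgeCoord_squareEdge (k : Fin 4) (t : ℝ) : edgeCoord k (squareEdge k t) = !₂[0, t] := by
  fin_cases k <;> simp [edgeCoord, squareEdge]

theorem squareEdge_mem (k : Fin 4) {t : ℝ} (ht : t ∈ Set.Icc (0 : ℝ) 1) :
    squareEdge k t ∈ unitSquare := by
  obtain ⟨h0, h1⟩ := ht
  intro i
  fin_cases k <;> fin_cases i <;> simp [squareEdge] <;> grind

/-- Only the edge `k` meets the interior of the domino around the edge `k`. -/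
theorem eq_of_edgeCoord_squareEdge {k k' : Fin 4} {t : ℝ}
    (h0 : edgeCoord k (squareEdge k' t) 0 < 1) (h1 : 0 < edgeCoord k (squareEdge k' t) 1)
    (h2 : edgeCoord k (squareEdge k' t) 1 < 1) : k' = k := by
  fin_cases k <;> fin_cases k' <;> simp [edgeCoord, squareEdge] at *

/-- A point that is close to the edge `k` and far from its ends is not close to another edge. -/
theorem eq_of_edgeCoord_lt {k l : Fin 4} {a : Plane} {δ : ℝ}
    (h : edgeCoord k a 0 + edgeCoord l a 0 < δ) (h0 : 0 ≤ edgeCoord k a 0) (_h1 : δ ≤ 1)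
    (h2 : δ ≤ edgeCoord k a 1) (h3 : edgeCoord k a 1 ≤ 1 - δ) : l = k := by
  fin_cases k <;> fin_cases l <;> simp [edgeCoord] at * <;> linarith

/-- The edge is taken parallel to an axis whose coordinate is strictly between 0 and 1. Of the two
candidates one passes through the point or lies at distance less than 1, so the point is interior to
the domino around it. -/
theorem exists_edgeCoord {a : Plane} (ha : a ∈ unitSquare) (h : ∃ k, a k ≠ 0 ∧ a k ≠ 1) :
    ∃ k, 0 ≤ edgeCoord k a 0 ∧ edgeCoord k a 0 < 1 ∧ 0 < edgeCoord k a 1 ∧ edgeCoord k a 1 < 1 := by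
  have h0 := ha 0
  have h1 := ha 1
  simp only [Set.mem_Icc] at h0 h1
  obtain ⟨k, hk⟩ := h
  fin_cases k
  · have h0' : 0 < a 0 := h0.1.lt_of_ne' hk.1
    have h0'' : a 0 < 1 := h0.2.lt_of_ne hk.2
    rcases h1.2.eq_or_lt with h | h
    · exact ⟨2, by simp [edgeCoord, h, h0', h0'']⟩
    · exact ⟨0, by simp [edgeCoord, h, h0', h0'', h1.1]⟩
  · have h1' : 0 < a 1 := h1.1.lt_of_ne' hk.1
    have h1'' : a 1 < 1 := h1.2.lt_of_ne hk.2
    rcases h0.2.eq_or_lt with h | h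
    · exact ⟨1, by simp [edgeCoord, h, h1', h1'']⟩
    · exact ⟨3, by simp [edgeCoord, h, h1', h1'', h0.1]⟩

namespace SquareGluing

variable {m : ℕ} (G : SquareGluing m)

/-- `z` is the position of the point `t` in the domino that consists of the square `i`, placed to
the right of its edge `k`, and the square glued to this edge, placed to the left. -/
def Unfolds (i : Fin m) (k : Fin 4) (t : G.diagram.Point) (z : Plane) : Prop :=
  (t.piece = i ∧ z = edgeCoord k t.pos) ∨
  (t.piece = (G.partner (i, k)).1 ∧
    z = mirrorCoord (G.flip (i, k)) (edgeCoord (G.partner (i, k)).2 t.pos))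

variable {G}

theorem mem_unitSquare (t : G.diagram.Point) : t.pos ∈ unitSquare := t.mem

theorem glue_symm {x y : G.diagram.Point} (h : G.diagram.glue x.piece x.pos y.piece y.pos) :
    G.diagram.glue y.piece y.pos x.piece x.pos := by
  obtain ⟨k, l, hkl, t, ht, hx, hy⟩ := h
  have hf : G.flip (y.piece, l) = G.flip (x.piece, k) := by rw [← hkl, G.flip_partner]
  refine ⟨l, k, by rw [← hkl, G.partner_partner], if G.flip (x.piece, k) then 1 - t else t, ?_, hy,
    ?_⟩
  · obtain ⟨h0, h1⟩ := ht
    split_ifs <;> constructor <;> linarith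
  · rw [hf, hx]
    cases G.flip (x.piece, k) <;> simp

/-- Inside the open domino only the common edge can be crossed, and there the two placements agree;
hence a jump does not change the position. -/
theorem Unfolds.of_glue {i : Fin m} {k : Fin 4} {x y : G.diagram.Point} {z : Plane}
    (hx : G.Unfolds i k x z) (hz0 : -1 < z 0) (hz0' : z 0 < 1) (hz1 : 0 < z 1) (hz1' : z 1 < 1)
    (h : G.diagram.glue x.piece x.pos y.piece y.pos) : G.Unfolds i k y z := by
  obtain ⟨k', l', hkl, t, ht, hxp, hyp⟩ := h
  rcases hx with ⟨rfl, hz⟩ | ⟨hxj, hz⟩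
  · rw [hxp] at hz
    obtain rfl : k' = k := eq_of_edgeCoord_squareEdge (hz ▸ hz0') (hz ▸ hz1) (hz ▸ hz1')
    right
    rw [hkl, hyp, hz]
    refine ⟨rfl, ?_⟩
    simp only [edgeCoord_squareEdge]
    cases G.flip (x.piece, k') <;> simp [mirrorCoord]
  · set l := (G.partner (i, k)).2 with hl
    rw [hxp] at hz
    have e0 : z 0 = -edgeCoord l (squareEdge k' t) 0 := by rw [hz]; simp [mirrorCoord]
    have e1 : z 1 = if G.flip (i, k) then 1 - edgeCoord l (squareEdge k' t) 1
        else edgeCoord l (squareEdge k' t) 1 := by rw [hz]; simp [mirrorCoord]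
    have hk' : k' = l := by
      apply eq_of_edgeCoord_squareEdge (t := t)
      · linarith
      all_goals split_ifs at e1 <;> linarith
    subst hk'
    have hp : G.partner (i, k) = (x.piece, l) := Prod.ext hxj.symm rfl
    have hp' : (i, k) = (y.piece, l') :=
      (G.partner_partner (i, k)).symm.trans ((congrArg G.partner hp).trans hkl)
    have hf : G.flip (x.piece, l) = G.flip (i, k) :=
      (congrArg G.flip hp).symm.trans (G.flip_partner (i, k))
    obtain ⟨rfl, rfl⟩ := Prod.mk.inj hp'
    left
    refine ⟨rfl, ?_⟩
    rw [hz, hyp, edgeCoord_squareEdge, edgeCoord_squareEdge, hf]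
    cases G.flip (y.piece, k) <;> simp [mirrorCoord]

theorem Unfolds.edist_eq {i : Fin m} {k : Fin 4} {j : Fin m} {a b : Plane} {ha hb} {z : Plane}
    (hx : G.Unfolds i k ⟨j, a, ha⟩ z) :
    ∃ z', G.Unfolds i k ⟨j, b, hb⟩ z' ∧ edist z z' = edist a b := by
  rcases hx with ⟨h, rfl⟩ | ⟨h, rfl⟩
  · exact ⟨_, Or.inl ⟨h, rfl⟩, (isometry_edgeCoord k).edist_eq _ _⟩
  · exact ⟨_, Or.inr ⟨h, rfl⟩,
      ((isometry_mirrorCoord _).comp (isometry_edgeCoord _)).edist_eq _ _⟩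

theorem abs_sub_lt_of_edist_lt {p z : Plane} {δ : ℝ} (h : edist p z < ENNReal.ofReal δ)
    (k : Fin 2) : |z k - p k| < δ := by
  rw [edist_dist] at h
  have h1 : dist p z < δ := (ENNReal.ofReal_lt_ofReal_iff_of_nonneg dist_nonneg).1 h
  refine lt_of_le_of_lt ?_ h1
  have h2 := PiLp.norm_apply_le (z - p) k
  rwa [← dist_eq_norm, dist_comm] at h2

/-- A path that starts in the middle of a domino and is short enough can be followed in the
domino. -/
theorem Unfolds.of_path {i : Fin m} {k : Fin 4} {p : Plane} {δ : ℝ} (h0 : δ ≤ 1 + p 0)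
    (h0' : δ ≤ 1 - p 0) (h1 : δ ≤ p 1) (h1' : δ ≤ 1 - p 1) {x y : G.diagram.Point} {r : ℝ≥0∞}
    (h : G.diagram.Path x y r) :
    (∀ z, G.Unfolds i k x z → edist p z + r < ENNReal.ofReal δ →
      ∃ z', G.Unfolds i k y z' ∧ edist z z' ≤ r) ∧
    (∀ z, G.Unfolds i k y z → edist p z + r < ENNReal.ofReal δ →
      ∃ z', G.Unfolds i k x z' ∧ edist z z' ≤ r) := by
  -- The distance from `p` plus the length still to be walked stays below `δ`, which keeps the
  -- position in the open domino, where jumps are harmless.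
  have hj : ∀ x y : G.diagram.Point, G.diagram.glue x.piece x.pos y.piece y.pos → ∀ z,
      G.Unfolds i k x z → edist p z + 0 < ENNReal.ofReal δ →
      ∃ z', G.Unfolds i k y z' ∧ edist z z' ≤ 0 := by
    intro x y hxy z hz hr
    rw [add_zero] at hr
    have e0 := abs_lt.1 (abs_sub_lt_of_edist_lt hr 0)
    have e1 := abs_lt.1 (abs_sub_lt_of_edist_lt hr 1)
    exact ⟨z, hz.of_glue (by linarith) (by linarith) (by linarith) (by linarith) hxy,
      (edist_self z).le⟩
  induction h with
  | segment j a b ha hb =>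
    refine ⟨fun z hz _ => ?_, fun z hz _ => ?_⟩
    · obtain ⟨z', hz', h⟩ := hz.edist_eq (b := b) (hb := hb)
      exact ⟨z', hz', h.le⟩
    · obtain ⟨z', hz', h⟩ := hz.edist_eq (b := a) (hb := ha)
      exact ⟨z', hz', by rw [h, edist_comm]⟩
  | jump x y h => exact ⟨hj x y h, hj y x (glue_symm h)⟩
  -- The induction treats both directions at once because paths may be reversed.
  | symm _ ih => exact ih.symm
  | @trans x y w r s _ _ ih ih' =>
    constructor
    · intro z hz hr
      rw [← add_assoc] at hr
      obtain ⟨z', hz', h⟩ := ih.1 z hz (lt_of_le_of_lt le_self_add hr)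
      obtain ⟨z'', hz'', h'⟩ := ih'.1 z' hz' (lt_of_le_of_lt
        (add_le_add_left ((edist_triangle p z z').trans (add_le_add_right h _)) _) hr)
      exact ⟨z'', hz'', (edist_triangle _ _ _).trans (add_le_add h h')⟩
    · intro z hz hr
      rw [add_comm r s, ← add_assoc] at hr
      obtain ⟨z', hz', h⟩ := ih'.2 z hz (lt_of_le_of_lt le_self_add hr)
      obtain ⟨z'', hz'', h'⟩ := ih.2 z' hz' (lt_of_le_of_lt
        (add_le_add_left ((edist_triangle p z z').trans (add_le_add_right h _)) _) hr)
      exact ⟨z'', hz'', (edist_triangle _ _ _).trans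
        ((add_le_add h h').trans (add_comm _ _).le)⟩

theorem mirrorCoord_edgeCoord_bounds (b : Bool) (k : Fin 4) {a : Plane} (ha : a ∈ unitSquare) :
    -1 ≤ mirrorCoord b (edgeCoord k a) 0 ∧ mirrorCoord b (edgeCoord k a) 0 ≤ 0 := by
  obtain ⟨h1, h2, -⟩ := edgeCoord_bounds k ha
  simp only [mirrorCoord]
  simp
  exact ⟨h2, h1⟩

/-- Two positions can arise only if a square is glued to itself, so that both cells of the domino
are the same square. If both positions were near `p`, the point would be close to both glued edges
and far from the ends of one of them; the edges would coincide, and no edge is its own partner. -/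
theorem Unfolds.unique {i : Fin m} {k : Fin 4} {p : Plane} {δ : ℝ} (hδ : 0 < δ)
    (h1 : 3 * δ ≤ p 1) (h1' : 3 * δ ≤ 1 - p 1) {x : G.diagram.Point} {z z' : Plane}
    (hz : G.Unfolds i k x z) (hz' : G.Unfolds i k x z') (hd : edist p z < ENNReal.ofReal δ)
    (hd' : edist p z' < ENNReal.ofReal δ) : z = z' := by
  wlog h : x.piece = i ∧ z = edgeCoord k x.pos generalizing z z'
  · by_cases h' : x.piece = i ∧ z' = edgeCoord k x.pos
    · exact (this hz' hz hd' hd h').symm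
    · rcases hz with hz | hz
      · exact absurd hz h
      rcases hz' with hz' | hz'
      · exact absurd hz' h'
      rw [hz.2, hz'.2]
  obtain ⟨hi, hz⟩ := h
  rcases hz' with ⟨-, hz'⟩ | ⟨hj, hz'⟩
  · rw [hz, hz']
  exfalso
  have a0 := abs_lt.1 (abs_sub_lt_of_edist_lt hd 0)
  have a1 := abs_lt.1 (abs_sub_lt_of_edist_lt hd 1)
  have b0 := abs_lt.1 (abs_sub_lt_of_edist_lt hd' 0)
  have e0 : z' 0 = -edgeCoord (G.partner (i, k)).2 x.pos 0 := by rw [hz']; simp [mirrorCoord]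
  have hb := edgeCoord_bounds k (mem_unitSquare x)
  rw [← hz] at hb
  have hl : (G.partner (i, k)).2 = k := by
    refine eq_of_edgeCoord_lt (δ := 2 * δ) (a := x.pos) ?_ ?_ (by linarith) ?_ ?_ <;> rw [← hz] <;> linarith
  exact G.partner_ne (i, k) (Prod.ext (hj.symm.trans hi) hl)

/-- Straight segments of the domino are paths of the glued surface. -/
theorem Unfolds.edist_le {i : Fin m} {k : Fin 4} {x y : G.diagram.Point} {z z' : Plane}
    (hx : G.Unfolds i k x z) (hy : G.Unfolds i k y z') (hz : 0 < z 1 ∧ z 1 < 1)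
    (hz' : 0 < z' 1 ∧ z' 1 < 1) : edist x y ≤ edist z z' := by
  obtain ⟨i₁, a, ha⟩ := x
  obtain ⟨i₂, b, hb⟩ := y
  wlog h : i₁ = i ∧ z = edgeCoord k a generalizing i₁ i₂ a b z z'
  · by_cases h' : i₂ = i ∧ z' = edgeCoord k b
    · rw [edist_comm, edist_comm z]
      exact this hz' hz i₂ b hb hy i₁ a ha hx h'
    · rcases hx with hx | hx
      · exact absurd hx h
      rcases hy with hy | hy
      · exact absurd hy h'
      obtain ⟨rfl, rfl⟩ := hx
      obtain ⟨rfl, rfl⟩ := hy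
      refine (GluingDiagram.edist_mk_le (D := G.diagram) _ ha hb).trans ?_
      exact (((isometry_mirrorCoord _).comp (isometry_edgeCoord _)).edist_eq a b).ge
  obtain ⟨rfl, rfl⟩ := h
  rcases hy with ⟨h2, rfl⟩ | ⟨hj, hz2⟩
  · obtain rfl : i₂ = i₁ := h2
    refine (GluingDiagram.edist_mk_le (D := G.diagram) _ ha hb).trans ?_
    exact ((isometry_edgeCoord k).edist_eq a b).ge
  set l := (G.partner (i₁, k)).2 with hl
  set c := G.flip (i₁, k) with hc
  obtain rfl : i₂ = (G.partner (i₁, k)).1 := hj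
  set z := edgeCoord k a with hzdef
  have hz0 := (edgeCoord_bounds k (show a ∈ unitSquare from ha)).1
  have hz0' : z' 0 ≤ 0 := hz2 ▸ (mirrorCoord_edgeCoord_bounds c l (show b ∈ unitSquare from hb)).2
  rw [← hzdef] at hz0
  -- The segment crosses the line of the common edge at `w`, and the bounds on the second
  -- coordinates put `w` on the edge itself. The path walks to `w`, jumps, and goes on in the other
  -- square.
  obtain ⟨w, hw, hw0⟩ : ∃ w ∈ segment ℝ z z', w 0 = 0 := by
    have hcont : Continuous fun w : Plane => w 0 := by fun_prop
    have hpre : IsPreconnected (segment ℝ z z') := (convex_segment z z').isPreconnected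
    exact hpre.intermediate_value (right_mem_segment ℝ z z') (left_mem_segment ℝ z z')
      hcont.continuousOn ⟨hz0', hz0⟩
  have hw1 : w 1 ∈ Set.Icc (0 : ℝ) 1 := by
    have hconv : Convex ℝ {w : Plane | w 1 ∈ Set.Icc (0 : ℝ) 1} :=
      (convex_Icc (0 : ℝ) 1).linear_preimage (EuclideanSpace.proj (1 : Fin 2) : Plane →L[ℝ] ℝ).toLinearMap
    exact hconv.segment_subset ⟨hz.1.le, hz.2.le⟩ ⟨hz'.1.le, hz'.2.le⟩ hw
  obtain ⟨t, ht⟩ : ∃ t : ℝ, t = w 1 := ⟨_, rfl⟩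
  rw [← ht] at hw1
  have hwe : w = !₂[0, t] := plane_ext (by simpa using hw0) (by simp [ht])
  set t' : ℝ := if c then 1 - t else t with ht'
  have ht'm : t' ∈ Set.Icc (0 : ℝ) 1 := by
    obtain ⟨h0, h1⟩ := hw1
    rw [ht']
    split_ifs <;> constructor <;> linarith
  have h1 := squareEdge_mem k hw1
  have h2 := squareEdge_mem l ht'm
  have d1 : edist (⟨i₁, a, ha⟩ : G.diagram.Point) ⟨i₁, squareEdge k t, h1⟩ ≤ edist z w := by
    refine (GluingDiagram.edist_mk_le (D := G.diagram) _ ha h1).trans ?_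
    rw [← (isometry_edgeCoord k).edist_eq, edgeCoord_squareEdge, ← hwe]
  have d2 : edist (⟨i₁, squareEdge k t, h1⟩ : G.diagram.Point)
      ⟨(G.partner (i₁, k)).1, squareEdge l t', h2⟩ = 0 :=
    GluingDiagram.edist_eq_zero_of_glue (D := G.diagram) ⟨k, l, rfl, t, hw1, rfl, rfl⟩
  have d3 : edist (⟨(G.partner (i₁, k)).1, squareEdge l t', h2⟩ : G.diagram.Point)
      ⟨(G.partner (i₁, k)).1, b, hb⟩ ≤ edist w z' := by
    refine (GluingDiagram.edist_mk_le (D := G.diagram) _ h2 hb).trans (le_of_eq ?_)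
    rw [← ((isometry_mirrorCoord c).comp (isometry_edgeCoord l)).edist_eq, Function.comp_apply,
      Function.comp_apply, edgeCoord_squareEdge, hz2, hwe]
    congr 1
    rw [ht']
    cases c <;> simp [mirrorCoord]
  have d4 : edist z w + edist w z' = edist z z' := by
    rw [edist_dist, edist_dist, edist_dist, ← ENNReal.ofReal_add dist_nonneg dist_nonneg,
      dist_add_dist_of_mem_segment hw]
  rw [← d4]
  refine (edist_triangle _ ⟨i₁, squareEdge k t, h1⟩ _).trans (add_le_add d1 ?_)
  refine (edist_triangle _ ⟨(G.partner (i₁, k)).1, squareEdge l t', h2⟩ _).trans ?_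
  rw [d2, zero_add]
  exact d3

/-- A point of the squares that represents the given point of the glued surface. -/
noncomputable def rep (s : G.diagram.Surface) : G.diagram.Point :=
  Function.surjInv SeparationQuotient.surjective_mk s

theorem mk_rep (s : G.diagram.Surface) : SeparationQuotient.mk (rep s) = s :=
  Function.surjInv_eq _ s

theorem edist_rep (s t : G.diagram.Surface) : edist (rep s) (rep t) = edist s t := by
  rw [← SeparationQuotient.edist_mk, mk_rep, mk_rep]

/-- The points of the glued surface with a corner of a square as representative. -/
def corners (G : SquareGluing m) : Set G.diagram.Surface :=
  {s | ∀ k, (rep s).pos k = 0 ∨ (rep s).pos k = 1}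

theorem finite_corners (G : SquareGluing m) : G.corners.Finite := by
  have hfin : ({a : Plane | ∀ k, a k = 0 ∨ a k = 1} : Set Plane).Finite := by
    have h : (Set.univ.pi fun _ : Fin 2 => ({0, 1} : Set ℝ)).Finite :=
      Set.Finite.pi fun _ => Set.toFinite _
    refine (h.preimage (WithLp.ofLp_injective 2).injOn).subset ?_
    intro a ha k _
    exact ha k
  refine Set.Finite.of_finite_image ((Set.finite_univ (α := Fin m)).prod hfin |>.subset ?_)
    (f := fun s : G.diagram.Surface => ((rep s).piece, (rep s).pos)) ?_
  · rintro _ ⟨s, hs, rfl⟩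
    exact ⟨Set.mem_univ _, hs⟩
  · intro s _ t _ h
    rw [← mk_rep s, ← mk_rep t]
    congr 1
    have h' := Prod.mk.inj h
    exact GluingDiagram.Point.ext h'.1 h'.2

/-- Away from finitely many points, a surface glued from squares has charts that place the squares
by isometries of the lattice. -/
theorem exists_chart (s : G.diagram.Surface) (hs : s ∉ G.corners) :
    ∃ ε > (0 : ℝ), ∃ ψ : G.diagram.Surface → Plane,
      (∀ t t', edist t s < ENNReal.ofReal ε → edist t' s < ENNReal.ofReal ε →
        edist (ψ t) (ψ t') = edist t t') ∧
      ∀ t, edist t s < ENNReal.ofReal ε → ∃ A ∈ placements, A (rep t).pos = ψ t := by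
  simp only [corners, Set.mem_ofPred_eq, not_forall, not_or] at hs
  obtain ⟨k, hk0, hk0', hk1, hk1'⟩ := exists_edgeCoord (mem_unitSquare (rep s)) hs
  set p := edgeCoord k (rep s).pos with hp
  -- A path from `p` to `ψ t` and on to `ψ t'` is shorter than `ε + 2ε`, so paths are followed
  -- within `3ε`; uniqueness of positions there needs three times as much room.
  obtain ⟨ε, hε, e0, e1, e1'⟩ : ∃ ε > (0 : ℝ), 9 * ε ≤ 1 - p 0 ∧ 9 * ε ≤ p 1 ∧ 9 * ε ≤ 1 - p 1 := by
    refine ⟨min (1 - p 0) (min (p 1) (1 - p 1)) / 9, ?_, ?_, ?_, ?_⟩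
    · have : 0 < min (1 - p 0) (min (p 1) (1 - p 1)) := by
        refine lt_min (by linarith) (lt_min hk1 (by linarith))
      positivity
    · rw [mul_div_cancel₀ _ (by norm_num)]
      exact min_le_left _ _
    · rw [mul_div_cancel₀ _ (by norm_num)]
      exact (min_le_right _ _).trans (min_le_left _ _)
    · rw [mul_div_cancel₀ _ (by norm_num)]
      exact (min_le_right _ _).trans (min_le_right _ _)
  set i := (rep s).piece with hi
  have hps : G.Unfolds i k (rep s) p := Or.inl ⟨rfl, rfl⟩
  have hpath : ∀ {x y : G.diagram.Point} {r : ℝ≥0∞}, G.diagram.Path x y r → ∀ z,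
      G.Unfolds i k x z → edist p z + r < ENNReal.ofReal (3 * ε) →
      ∃ z', G.Unfolds i k y z' ∧ edist z z' ≤ r := fun h =>
    (Unfolds.of_path (by linarith) (by linarith) (by linarith) (by linarith) h).1
  have huniq : ∀ {x : G.diagram.Point} {z z' : Plane}, G.Unfolds i k x z → G.Unfolds i k x z' →
      edist p z < ENNReal.ofReal (3 * ε) → edist p z' < ENNReal.ofReal (3 * ε) → z = z' :=
    fun h h' => Unfolds.unique (by linarith) (by linarith) (by linarith) h h'
  have hex : ∀ t : G.diagram.Surface, edist t s < ENNReal.ofReal ε →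
      ∃ z, G.Unfolds i k (rep t) z ∧ edist p z < ENNReal.ofReal ε := by
    intro t ht
    rw [edist_comm, ← edist_rep] at ht
    obtain ⟨r, hr, hpa⟩ := GluingDiagram.exists_path_of_edist_lt ht
    have hr' : edist p p + r < ENNReal.ofReal (3 * ε) := by
      rw [edist_self, zero_add]
      exact hr.trans_le (ENNReal.ofReal_le_ofReal (by linarith))
    obtain ⟨z, hz, hd⟩ := hpath hpa p hps hr'
    exact ⟨z, hz, hd.trans_lt hr⟩
  have hε3 : ENNReal.ofReal (3 * ε) = ENNReal.ofReal ε + (ENNReal.ofReal ε + ENNReal.ofReal ε) := by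
    rw [← ENNReal.ofReal_add hε.le hε.le, ← ENNReal.ofReal_add hε.le (by linarith)]
    congr 1
    ring
  choose! ψ hψ hψd using hex
  refine ⟨ε, hε, ψ, fun t t' ht ht' => ?_, fun t ht => ?_⟩
  · rw [← edist_rep t t']
    have hlt : ENNReal.ofReal ε < ENNReal.ofReal (3 * ε) :=
      (ENNReal.ofReal_lt_ofReal_iff (by linarith)).2 (by linarith)
    apply le_antisymm
    -- A nearly shortest path between the points lifts to the domino, and by uniqueness its lift
    -- ends at the chosen position `ψ t'`.
    · refine le_of_forall_gt_imp_ge_of_dense fun r hr => ?_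
      have hr' : edist (rep t) (rep t') < min r (ENNReal.ofReal ε + ENNReal.ofReal ε) := by
        refine lt_min hr ?_
        rw [edist_rep]
        exact (edist_triangle_right t t' s).trans_lt (ENNReal.add_lt_add ht ht')
      obtain ⟨r', hr', hpa⟩ := GluingDiagram.exists_path_of_edist_lt hr'
      have hsum : edist p (ψ t) + r' < ENNReal.ofReal (3 * ε) := by
        rw [hε3]
        exact ENNReal.add_lt_add (hψd t ht) (hr'.trans_le (min_le_right _ _))
      obtain ⟨z, hz, hd⟩ := hpath hpa (ψ t) (hψ t ht) hsum
      have hz' : z = ψ t' := by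
        refine huniq hz (hψ t' ht') ?_ ((hψd t' ht').trans hlt)
        exact (edist_triangle _ (ψ t) _).trans_lt
          ((add_le_add_right hd _).trans_lt hsum)
      rw [← hz']
      exact hd.trans (hr'.le.trans (min_le_left _ _))
    · have hb : ∀ t, edist t s < ENNReal.ofReal ε → 0 < ψ t 1 ∧ ψ t 1 < 1 := by
        intro t ht
        have := abs_lt.1 (abs_sub_lt_of_edist_lt (hψd t ht) 1)
        constructor <;> linarith
      exact Unfolds.edist_le (hψ t ht) (hψ t' ht') (hb t ht) (hb t' ht')
  · rcases hψ t ht with ⟨-, h⟩ | ⟨-, h⟩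
    · refine ⟨edgeIso k, Or.inl ⟨k, rfl⟩, ?_⟩
      rw [h, edgeIso, affineIsometryOfInvolutive_apply]
    · refine ⟨mirrorIso (G.flip (i, k)) * edgeIso (G.partner (i, k)).2, Or.inr ⟨(_, _), rfl⟩, ?_⟩
      rw [h, AffineIsometryEquiv.coe_mul, Function.comp_apply, edgeIso, mirrorIso,
        affineIsometryOfInvolutive_apply, affineIsometryOfInvolutive_apply]

end SquareGluing

/-! ### Planar isometries -/

/-- A distance preserving map on a set with non-empty interior extends to an isometry of the
plane. -/
theorem exists_affineIsometryEquiv {A : Set Plane} (hA : (interior A).Nonempty) {f : Plane → Plane}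
    (hf : ∀ x ∈ A, ∀ y ∈ A, edist (f x) (f y) = edist x y) :
    ∃ τ : Plane ≃ᵃⁱ[ℝ] Plane, ∀ x ∈ A, f x = τ x := by
  obtain ⟨a, ha⟩ := hA
  obtain ⟨r, hr, hball⟩ := Metric.isOpen_iff.1 isOpen_interior a ha
  have haA := interior_subset ha
  have hdist : ∀ x ∈ A, ∀ y ∈ A, dist (f x) (f y) = dist x y := fun x hx y hy => by
    rw [dist_edist, dist_edist, hf x hx y hy]
  -- By polarization, distances from `a` determine inner products.
  have hinner : ∀ x ∈ A, ∀ y ∈ A,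
      inner ℝ (f x - f a) (f y - f a) = inner ℝ (x - a) (y - a) := by
    intro x hx y hy
    have h1 := hdist x hx a haA
    have h2 := hdist y hy a haA
    have h3 := hdist x hx y hy
    simp only [dist_eq_norm] at h1 h2 h3
    rw [real_inner_eq_norm_mul_self_add_norm_mul_self_sub_norm_sub_mul_self_div_two,
      real_inner_eq_norm_mul_self_add_norm_mul_self_sub_norm_sub_mul_self_div_two,
      sub_sub_sub_cancel_right, sub_sub_sub_cancel_right, h1, h2, h3]
  let e := EuclideanSpace.basisFun (Fin 2) ℝ
  have hp : ∀ k, a + (r / 2) • e k ∈ A := by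
    intro k
    refine interior_subset (hball ?_)
    rw [Metric.mem_ball, dist_eq_norm, add_sub_cancel_left, norm_smul, e.orthonormal.1, mul_one,
      Real.norm_of_nonneg (by positivity)]
    linarith
  -- The rescaled images of the two axis directions: an orthonormal basis in which `f` has the
  -- coordinates of its argument.
  let v : Fin 2 → Plane := fun k => (r / 2)⁻¹ • (f (a + (r / 2) • e k) - f a)
  have hr2 : r / 2 ≠ 0 := by positivity
  have hvi : ∀ k, ∀ y ∈ A, inner ℝ (v k) (f y - f a) = inner ℝ (e k) (y - a) := by
    intro k y hy
    rw [inner_smul_left, hinner _ (hp k) y hy, add_sub_cancel_left, inner_smul_left]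
    simp only [conj_trivial]
    rw [inv_mul_cancel_left₀ hr2]
  have hv : Orthonormal ℝ v := by
    rw [orthonormal_iff_ite]
    intro i j
    have h := orthonormal_iff_ite.1 e.orthonormal i j
    rw [← h]
    show inner ℝ (v i) ((r / 2)⁻¹ • (f (a + (r / 2) • e j) - f a)) = _
    rw [inner_smul_right, hvi i _ (hp j), add_sub_cancel_left, inner_smul_right,
      inv_mul_cancel_left₀ hr2]
  obtain ⟨b, hb⟩ := Orthonormal.exists_orthonormalBasis_extension_of_card_eq
    (𝕜 := ℝ) (E := Plane) (ι := Fin 2) (by simp) (v := v) (s := Set.univ)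
    (hv.comp _ Subtype.val_injective)
  refine ⟨AffineIsometryEquiv.mk' (fun x => b.repr.symm (x - a) + f a) b.repr.symm a
    (fun x => by simp), fun x hx => ?_⟩
  rw [AffineIsometryEquiv.coe_mk', ← sub_eq_iff_eq_add, LinearIsometryEquiv.eq_symm_apply]
  ext k
  rw [b.repr_apply_apply, hb k (Set.mem_univ k), hvi k x hx]
  simp [e, EuclideanSpace.basisFun_apply, EuclideanSpace.inner_single_left]

/-- The coincidence set is empty or a proper affine subspace. This lets finitely many candidate
isometries be told apart by measure. -/
theorem volume_eqLocus {τ τ' : Plane ≃ᵃⁱ[ℝ] Plane} (h : τ ≠ τ') :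
    volume {x | τ x = τ' x} = 0 := by
  by_cases hne : ∃ x₀, τ x₀ = τ' x₀
  · obtain ⟨x₀, hx₀⟩ := hne
    let L : Plane →ₗ[ℝ] Plane :=
      τ.linearIsometryEquiv.toLinearMap - τ'.linearIsometryEquiv.toLinearMap
    have hL : ∀ x, L (x - x₀) = τ x - τ' x := by
      intro x
      have h1 := τ.map_vsub x x₀
      have h2 := τ'.map_vsub x x₀
      simp only [vsub_eq_sub] at h1 h2
      show τ.linearIsometryEquiv (x - x₀) - τ'.linearIsometryEquiv (x - x₀) = _
      rw [h1, h2, hx₀]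
      abel
    let S : AffineSubspace ℝ Plane := AffineSubspace.mk' x₀ (LinearMap.ker L)
    have hS : ∀ x, x ∈ S ↔ τ x = τ' x := by
      intro x
      rw [AffineSubspace.mem_mk', LinearMap.mem_ker, vsub_eq_sub, hL, sub_eq_zero]
    have hS' : {x | τ x = τ' x} = (S : Set Plane) := by
      ext x
      exact (hS x).symm
    rw [hS']
    refine Measure.addHaar_affineSubspace _ _ fun htop => h ?_
    ext1 x
    rw [← hS, htop]
    trivial
  · push Not at hne
    rw [Set.eq_empty_of_forall_notMem (s := {x | τ x = τ' x}) hne, measure_empty]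

/-! ### Developing along segments -/

/-- Near `x`, the isometry `τ` carries the points of `K` to the same positions as the map `q`, up to
placements. -/
def LocalDev (K : Set Plane) (q : Plane → Plane) (x : Plane) (τ : Plane ≃ᵃⁱ[ℝ] Plane) : Prop :=
  ∃ ε > 0, ∀ y ∈ K, dist y x < ε → ∃ A ∈ placements, A (q y) = τ y

variable {K : Set Plane} {q : Plane → Plane}

/-- Near `x`, each point of `K` satisfies `τ = A A'⁻¹ τ'` for some pair of placements depending on
the point. Finitely many such coincidence sets cover a non-empty open set, so one of them is not
null and the equality holds everywhere. No continuity of `q` is needed, so arbitrary representatives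
in the squares may be used. -/
theorem LocalDev.unique (hK : Convex ℝ K) (hi : (interior K).Nonempty) {x : Plane} (hx : x ∈ K)
    {τ τ' : Plane ≃ᵃⁱ[ℝ] Plane} (h : LocalDev K q x τ) (h' : LocalDev K q x τ') :
    ∃ w ∈ latticeGroup, τ = w * τ' := by
  obtain ⟨ε, hε, h⟩ := h
  obtain ⟨ε', hε', h'⟩ := h'
  by_contra hcon
  push Not at hcon
  set O := interior K ∩ Metric.ball x (min ε ε') with hO
  have hOo : IsOpen O := isOpen_interior.inter Metric.isOpen_ball
  have hOn : O.Nonempty := by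
    have hcl : x ∈ closure (interior K) := by
      rw [hK.closure_interior_eq_closure_of_nonempty_interior hi]
      exact subset_closure hx
    obtain ⟨y, hy, hd⟩ := Metric.mem_closure_iff.1 hcl (min ε ε') (lt_min hε hε')
    exact ⟨y, hy, by rwa [Metric.mem_ball, dist_comm]⟩
  have hsub : O ⊆ ⋃ p ∈ placements ×ˢ placements, {y | τ y = (p.1 * p.2⁻¹ * τ') y} := by
    intro y hy
    obtain ⟨A, hA, e⟩ := h y (interior_subset hy.1) (hy.2.trans_le (min_le_left _ _))
    obtain ⟨A', hA', e'⟩ := h' y (interior_subset hy.1) (hy.2.trans_le (min_le_right _ _))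
    refine Set.mem_biUnion (x := (A, A')) ⟨hA, hA'⟩ ?_
    show τ y = (A * A'⁻¹ * τ') y
    rw [← e, AffineIsometryEquiv.coe_mul, Function.comp_apply, ← e', AffineIsometryEquiv.coe_mul,
      Function.comp_apply, AffineIsometryEquiv.coe_inv, AffineIsometryEquiv.symm_apply_apply]
  have hnull : volume (⋃ p ∈ placements ×ˢ placements, {y | τ y = (p.1 * p.2⁻¹ * τ') y}) = 0 := by
    rw [measure_biUnion_null_iff (finite_placements.prod finite_placements).countable]
    rintro ⟨A, A'⟩ ⟨hA, hA'⟩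
    exact volume_eqLocus (hcon _ (latticeGroup.mul_mem (placements_subset hA)
      (latticeGroup.inv_mem (placements_subset hA'))))
  exact (hOo.measure_pos volume hOn).ne' (measure_mono_null hsub hnull)

/-- Agreement up to the lattice group is an equivalence relation, locally constant by
`LocalDev.unique`, and a segment is connected. -/
theorem LocalDev.along_segment (hK : Convex ℝ K) (hi : (interior K).Nonempty) {x y : Plane}
    (hx : x ∈ K) (hy : y ∈ K) (h : ∀ z ∈ segment ℝ x y, ∃ τ, LocalDev K q z τ)
    {τ τ' : Plane ≃ᵃⁱ[ℝ] Plane} (hτ : LocalDev K q x τ) (hτ' : LocalDev K q y τ') :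
    ∃ w ∈ latticeGroup, τ' = w * τ := by
  have hsub := hK.segment_subset hx hy
  have hpre : IsPreconnected (segment ℝ x y) := (convex_segment x y).isPreconnected
  refine hpre.induction₂ (fun x y => ∀ τ τ', LocalDev K q x τ → LocalDev K q y τ' →
    ∃ w ∈ latticeGroup, τ' = w * τ) ?_ ?_ ?_ (left_mem_segment ℝ x y) (right_mem_segment ℝ x y)
    τ τ' hτ hτ'
  · intro z hz
    obtain ⟨σ, hσ⟩ := h z hz
    obtain ⟨ε, hε, hε'⟩ := hσ
    refine Filter.eventually_of_mem (Filter.inter_mem self_mem_nhdsWithin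
      (mem_nhdsWithin_of_mem_nhds (Metric.ball_mem_nhds z hε))) ?_
    rintro z' ⟨hz', hd⟩ τ τ' hτ hτ'
    have hσ' : LocalDev K q z' σ := by
      refine ⟨ε - dist z' z, by rw [Metric.mem_ball] at hd; linarith, fun y hy hyd => ?_⟩
      exact hε' y hy (lt_of_le_of_lt (dist_triangle y z' z) (by linarith))
    obtain ⟨w, hw, e⟩ := hσ'.unique hK hi (hsub hz') hτ'
    obtain ⟨w', hw', e'⟩ := LocalDev.unique hK hi (hsub hz) ⟨ε, hε, hε'⟩ hτ
    refine ⟨w⁻¹ * w', latticeGroup.mul_mem (latticeGroup.inv_mem hw) hw', ?_⟩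
    rw [mul_assoc, ← e', e, inv_mul_cancel_left]
  · intro a b c ha hb hc hab hbc τ τ' hτ hτ'
    obtain ⟨σ, hσ⟩ := h b hb
    obtain ⟨w, hw, e⟩ := hab τ σ hτ hσ
    obtain ⟨w', hw', e'⟩ := hbc σ τ' hσ hτ'
    exact ⟨w' * w, latticeGroup.mul_mem hw' hw, by rw [e', e, mul_assoc]⟩
  · intro a b ha hb hab τ τ' hτ hτ'
    obtain ⟨w, hw, e⟩ := hab τ' τ hτ' hτ
    exact ⟨w⁻¹, latticeGroup.inv_mem hw, by rw [e, inv_mul_cancel_left]⟩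

/-! ### Edge lines -/

/-- The standard bilinear form of the plane. -/
def dot (u x : Plane) : ℝ := u 0 * x 0 + u 1 * x 1

theorem dot_eq_inner (u x : Plane) : dot u x = inner ℝ u x := by
  simp [dot, PiLp.inner_apply, Fin.sum_univ_two, mul_comm]

theorem dot_add (u x y : Plane) : dot u (x + y) = dot u x + dot u y := by
  simp [dot]
  ring

theorem dot_sub (u x y : Plane) : dot u (x - y) = dot u x - dot u y := by
  simp [dot]
  ring

theorem dot_smul (u : Plane) (c : ℝ) (x : Plane) : dot u (c • x) = c * dot u x := by
  simp [dot]
  ring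

theorem continuous_dot (u : Plane) : Continuous (dot u) := by
  unfold dot
  fun_prop

/-- The line `dot u x = h` supports `K`, with outer unit normal `u`, and contains at least two
points of `K`. -/
structure IsEdgeLine (K : Set Plane) (u : Plane) (h : ℝ) : Prop where
  unit : dot u u = 1
  le : ∀ x ∈ K, dot u x ≤ h
  exists_ne : ∃ a ∈ K, ∃ b ∈ K, a ≠ b ∧ dot u a = h ∧ dot u b = h

theorem dot_lt_of_mem_interior {K : Set Plane} {u : Plane} {h : ℝ} (hu : 0 < dot u u)
    (hK : ∀ x ∈ K, dot u x ≤ h) {x : Plane} (hx : x ∈ interior K) : dot u x < h := by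
  have hc : Filter.Tendsto (fun t : ℝ => x + t • u) (nhdsWithin 0 (Set.Ioi 0)) (nhds x) := by
    have : Continuous fun t : ℝ => x + t • u := by fun_prop
    have h0 := this.tendsto 0
    simp only [zero_smul, add_zero] at h0
    exact h0.mono_left nhdsWithin_le_nhds
  have h1 := hc.eventually (mem_interior_iff_mem_nhds.1 hx)
  obtain ⟨t, ht, ht0⟩ := (h1.and self_mem_nhdsWithin).exists
  have h2 := hK _ ht
  rw [dot_add, dot_smul] at h2
  have : 0 < t * dot u u := mul_pos ht0 hu
  linarith

/-- The reflection in the line `dot u x = h`, for a unit vector `u`. -/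
noncomputable def reflect (u : Plane) (h : ℝ) (x : Plane) : Plane := x - (2 * (dot u x - h)) • u

theorem reflect_reflect {u : Plane} (hu : dot u u = 1) (h : ℝ) (x : Plane) :
    reflect u h (reflect u h x) = x := by
  unfold reflect
  rw [dot_sub, dot_smul, hu]
  module

/-- The distances to two fixed points leave for each image only the point itself or its mirror
image. The choice made at `a + u`, which is off the line, forces the choice everywhere else. -/
theorem eq_reflect {u : Plane} (hu : dot u u = 1) {h : ℝ} {a b : Plane} (hab : a ≠ b)
    (ha : dot u a = h) (hb : dot u b = h) {σ : Plane ≃ᵃⁱ[ℝ] Plane} (hσa : σ a = a) (hσb : σ b = b)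
    (hσ : σ ≠ 1) (x : Plane) : σ x = reflect u h x := by
  have hdist : ∀ x y, (σ x 0 - σ y 0) ^ 2 + (σ x 1 - σ y 1) ^ 2 =
      (x 0 - y 0) ^ 2 + (x 1 - y 1) ^ 2 := by
    intro x y
    rw [← plane_dist_sq, ← plane_dist_sq, σ.dist_map]
  have hne : -u 1 * (b 0 - a 0) + u 0 * (b 1 - a 1) ≠ 0 := by
    intro h0
    apply hab
    unfold dot at *
    have e1 : u 0 * (b 0 - a 0) + u 1 * (b 1 - a 1) = 0 := by linarith
    refine plane_ext ?_ ?_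
    · have : (u 0 * u 0 + u 1 * u 1) * (b 0 - a 0) = 0 := by linear_combination u 0 * e1 - u 1 * h0
      rw [hu] at this
      linarith
    · have : (u 0 * u 0 + u 1 * u 1) * (b 1 - a 1) = 0 := by linear_combination u 1 * e1 + u 0 * h0
      rw [hu] at this
      linarith
  have hor : ∀ x, σ x = x ∨ σ x = reflect u h x := by
    intro x
    have h1 := hdist x a
    have h2 := hdist x b
    rw [hσa] at h1
    rw [hσb] at h2
    set y := σ x
    unfold dot at hu ha hb
    have e1 : (y 0 - x 0) * (b 0 - a 0) + (y 1 - x 1) * (b 1 - a 1) = 0 := by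
      linear_combination (h1 - h2) / 2
    have e2 : u 0 * (b 0 - a 0) + u 1 * (b 1 - a 1) = 0 := by linarith
    have e3 : (-u 1 * (y 0 - x 0) + u 0 * (y 1 - x 1)) *
        (-u 1 * (b 0 - a 0) + u 0 * (b 1 - a 1)) = 0 := by
      linear_combination (u 0 * u 0 + u 1 * u 1) * e1 -
        (u 0 * (y 0 - x 0) + u 1 * (y 1 - x 1)) * e2
    have e4 := (mul_eq_zero.1 e3).resolve_right hne
    set c := u 0 * (y 0 - x 0) + u 1 * (y 1 - x 1) with hc
    have f0 : y 0 - x 0 = c * u 0 := by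
      linear_combination (-(y 0 - x 0)) * hu - u 1 * e4 + u 0 * hc
    have f1 : y 1 - x 1 = c * u 1 := by
      linear_combination (-(y 1 - x 1)) * hu + u 0 * e4 + u 1 * hc
    have f2 : c * (c + 2 * (dot u x - h)) = 0 := by
      have g0 : y 0 = x 0 + c * u 0 := by linarith
      have g1 : y 1 = x 1 + c * u 1 := by linarith
      rw [g0, g1] at h1
      unfold dot
      linear_combination h1 + 2 * c * ha - c ^ 2 * hu
    rcases mul_eq_zero.1 f2 with h0 | h0
    · left
      rw [h0] at f0 f1
      exact plane_ext (by linarith) (by linarith)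
    · right
      have : c = -(2 * (dot u x - h)) := by linarith
      rw [this] at f0 f1
      refine plane_ext ?_ ?_ <;> simp [reflect] <;> linarith
  have hcase : ∀ x, dot u x = h → reflect u h x = x := by
    intro x hx
    simp [reflect, hx]
  have hau : dot u (a + u) = h + 1 := by rw [dot_add, ha, hu]
  rcases hor (a + u) with h1 | h1
  · exfalso
    apply hσ
    ext1 x
    rcases hor x with h2 | h2
    · exact h2
    · rw [AffineIsometryEquiv.coe_one, id, h2]
      apply hcase
      have h3 := hdist x (a + u)
      rw [h1, h2] at h3
      simp only [reflect, PiLp.sub_apply, PiLp.add_apply, PiLp.smul_apply, smul_eq_mul] at h3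
      unfold dot at *
      set s := u 0 * x 0 + u 1 * x 1 - h with hs
      linear_combination h3 / 4 - s * hu - s * ha - s ^ 2 * hu
  · rcases hor x with h2 | h2
    · rw [h2]
      symm
      apply hcase
      have h3 := hdist x (a + u)
      rw [h1, h2] at h3
      simp only [reflect, hau, PiLp.sub_apply, PiLp.add_apply, PiLp.smul_apply, smul_eq_mul] at h3
      unfold dot at *
      linear_combination h3 / 4 + ha
    · exact h2

theorem infinite_segment {a b : Plane} (hab : a ≠ b) : (segment ℝ a b).Infinite := by
  rw [segment_eq_image_lineMap]
  exact (Set.Icc_infinite one_pos).image (AffineMap.lineMap_injective ℝ hab).injOn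

theorem dot_eq_of_mem_segment {u a b x : Plane} {h : ℝ} (ha : dot u a = h) (hb : dot u b = h)
    (hx : x ∈ segment ℝ a b) : dot u x = h := by
  obtain ⟨s, t, -, -, hst, rfl⟩ := hx
  rw [dot_add, dot_smul, dot_smul, ha, hb, ← add_mul, hst, one_mul]

/-- A segment on a line contains points that are seen from a point off the line without meeting
finitely many obstacles. -/
theorem exists_segment_disjoint {u a b o : Plane} {h : ℝ} (hab : a ≠ b) (ha : dot u a = h)
    (hb : dot u b = h) (ho : dot u o ≠ h) {B : Set Plane} (hB : B.Finite) (hoB : o ∉ B) :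
    ∃ p ∈ segment ℝ a b, ∀ z ∈ segment ℝ o p, z ∉ B := by
  have hfin : (⋃ β ∈ B, {p ∈ segment ℝ a b | β ∈ segment ℝ o p}).Finite := by
    -- The ray from `o` through an obstacle `β` meets the line at most once, so each obstacle blocks
    -- at most one point.
    refine hB.biUnion fun β hβ => Set.Subsingleton.finite ?_
    rintro p ⟨hp, s, t, hs, ht, hst, e⟩ p' ⟨hp', s', t', hs', ht', hst', e'⟩
    have hp := dot_eq_of_mem_segment ha hb hp
    have hp' := dot_eq_of_mem_segment ha hb hp'
    have d : dot u β = s * dot u o + t * h := by rw [← e, dot_add, dot_smul, dot_smul, hp]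
    have d' : dot u β = s' * dot u o + t' * h := by rw [← e', dot_add, dot_smul, dot_smul, hp']
    have htt : (t - t') * (h - dot u o) = 0 := by
      linear_combination d' - d - (dot u o) * hst + (dot u o) * hst'
    have ht1 : t = t' := by
      rcases mul_eq_zero.1 htt with h1 | h1
      · linarith
      · exact absurd (by linarith) ho
    have hs1 : s = s' := by linarith
    subst ht1 hs1
    have ht0 : t ≠ 0 := by
      rintro rfl
      apply hoB
      have : s = 1 := by linarith
      rw [this] at e
      simp only [one_smul, zero_smul, add_zero] at e
      rwa [e]
    have h2 : t • p = t • p' := add_left_cancel (e.trans e'.symm)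
    exact smul_right_injective _ ht0 h2
  obtain ⟨p, hp, hp'⟩ := ((infinite_segment hab).sdiff hfin).nonempty
  refine ⟨p, hp, fun z hz hzB => hp' ?_⟩
  exact Set.mem_biUnion hzB ⟨hp, hz⟩

theorem exists_interior_inter_ball {K : Set Plane} (hK : Convex ℝ K) (hi : (interior K).Nonempty)
    {x : Plane} (hx : x ∈ K) {ε : ℝ} (hε : 0 < ε) : ∃ y ∈ interior K, dist y x < ε := by
  have hcl : x ∈ closure (interior K) := by
    rw [hK.closure_interior_eq_closure_of_nonempty_interior hi]
    exact subset_closure hx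
  obtain ⟨y, hy, hd⟩ := Metric.mem_closure_iff.1 hcl ε hε
  exact ⟨y, hy, by rwa [dist_comm]⟩

theorem exists_mem_segment_near {a b p : Plane} (hab : a ≠ b) (hp : p ∈ segment ℝ a b) {ε : ℝ}
    (hε : 0 < ε) : ∃ y ∈ segment ℝ a b, y ≠ p ∧ dist y p < ε := by
  obtain ⟨c, hc, hcp⟩ : ∃ c ∈ segment ℝ a b, c ≠ p := by
    obtain ⟨c, hc, hcp⟩ := ((infinite_segment hab).sdiff (Set.finite_singleton p)).nonempty
    exact ⟨c, hc, hcp⟩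
  have hd : 0 < dist p c := dist_pos.2 hcp.symm
  set t : ℝ := min 1 (ε / (2 * dist p c)) with ht
  have ht0 : 0 < t := lt_min one_pos (by positivity)
  refine ⟨AffineMap.lineMap p c t, ?_, ?_, ?_⟩
  · exact (convex_segment a b).lineMap_mem hp hc ⟨ht0.le, min_le_left _ _⟩
  · rw [Ne, AffineMap.lineMap_eq_left_iff]
    rintro (h | h)
    · exact hcp h.symm
    · exact ht0.ne' h
  · rw [dist_lineMap_left, Real.norm_of_nonneg ht0.le]
    calc t * dist p c ≤ ε / (2 * dist p c) * dist p c := by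
          gcongr
          exact min_le_right _ _
      _ = ε / 2 := by field_simp
      _ < ε := by linarith

/-! ### Developing the two sheets -/

/-- Two isometric sheets in a glued surface, with common boundary and disjoint interiors, develop to
the plane with the square lattice, each on its side of any edge line. -/
theorem exists_developments {m : ℕ} {G : SquareGluing m} {K : Set Plane} (hK : Convex ℝ K)
    (hi : (interior K).Nonempty) {up low : Plane → G.diagram.Surface}
    (hup : ∀ x ∈ K, ∀ y ∈ K, edist (up x) (up y) = edist x y)
    (hlow : ∀ x ∈ K, ∀ y ∈ K, edist (low x) (low y) = edist x y)
    (hfr : ∀ x ∈ K, x ∈ frontier K → up x = low x) (hint : ∀ x ∈ interior K, up x ≠ low x) :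
    ∃ τ κ : Plane ≃ᵃⁱ[ℝ] Plane, ∀ u h, IsEdgeLine K u h →
      ∃ w ∈ latticeGroup, ∀ x, κ x = w (τ (reflect u h x)) := by
  classical
  -- The points where one of the sheets runs into a corner; finite because the sheets are injective
  -- on `K`.
  set B : Set Plane := {x ∈ K | up x ∈ G.corners} ∪ {x ∈ K | low x ∈ G.corners} with hB
  have hBfin : B.Finite := by
    have hgen : ∀ f : Plane → G.diagram.Surface,
        (∀ x ∈ K, ∀ y ∈ K, edist (f x) (f y) = edist x y) → {x ∈ K | f x ∈ G.corners}.Finite := by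
      intro f hf
      refine Set.Finite.of_finite_image (G.finite_corners.subset ?_) (f := f) ?_
      · rintro _ ⟨x, hx, rfl⟩
        exact hx.2
      · intro x hx y hy hxy
        have := hf x hx.1 y hy.1
        rw [hxy, edist_self] at this
        exact edist_eq_zero.1 this.symm
    exact (hgen up hup).union (hgen low hlow)
  have hA : ∀ x ∈ K, ∀ ε > (0 : ℝ), (interior {y ∈ K | dist y x < ε}).Nonempty := by
    intro x hx ε hε
    obtain ⟨y, hy, hd⟩ := exists_interior_inter_ball hK hi hx hε
    refine ⟨y, mem_interior.2 ⟨interior K ∩ Metric.ball x ε, ?_,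
      isOpen_interior.inter Metric.isOpen_ball, hy, hd⟩⟩
    exact fun z hz => ⟨interior_subset hz.1, hz.2⟩
  have hchart : ∀ f : Plane → G.diagram.Surface,
      (∀ x ∈ K, ∀ y ∈ K, edist (f x) (f y) = edist x y) → ∀ x ∈ K, ∀ ε > (0 : ℝ),
      ∀ ψ : G.diagram.Surface → Plane,
      (∀ t t', edist t (f x) < ENNReal.ofReal ε → edist t' (f x) < ENNReal.ofReal ε →
        edist (ψ t) (ψ t') = edist t t') →
      (∀ t, edist t (f x) < ENNReal.ofReal ε →
        ∃ A ∈ placements, A (SquareGluing.rep t).pos = ψ t) →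
      ∃ τ : Plane ≃ᵃⁱ[ℝ] Plane, (∀ y ∈ K, dist y x < ε → ψ (f y) = τ y) ∧
        LocalDev K (fun y => (SquareGluing.rep (f y)).pos) x τ := by
    intro f hf x hx ε hε ψ h1 h2
    have hnear : ∀ y ∈ K, dist y x < ε → edist (f y) (f x) < ENNReal.ofReal ε := by
      intro y hy hd
      rw [hf y hy x hx, edist_dist]
      exact (ENNReal.ofReal_lt_ofReal_iff hε).2 hd
    obtain ⟨τ, hτ⟩ := exists_affineIsometryEquiv (hA x hx ε hε) (f := fun y => ψ (f y))
      (fun y hy z hz => by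
        rw [h1 _ _ (hnear y hy.1 hy.2) (hnear z hz.1 hz.2), hf y hy.1 z hz.1])
    refine ⟨τ, fun y hy hd => hτ y ⟨hy, hd⟩, ε, hε, fun y hy hd => ?_⟩
    obtain ⟨A, hA, e⟩ := h2 _ (hnear y hy hd)
    exact ⟨A, hA, e.trans (hτ y ⟨hy, hd⟩)⟩
  have hdev : ∀ f : Plane → G.diagram.Surface,
      (∀ x ∈ K, ∀ y ∈ K, edist (f x) (f y) = edist x y) → ∀ x ∈ K, f x ∉ G.corners →
      ∃ τ, LocalDev K (fun y => (SquareGluing.rep (f y)).pos) x τ := by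
    intro f hf x hx hxc
    obtain ⟨ε, hε, ψ, h1, h2⟩ := SquareGluing.exists_chart (f x) hxc
    obtain ⟨τ, -, hτ⟩ := hchart f hf x hx ε hε ψ h1 h2
    exact ⟨τ, hτ⟩
  obtain ⟨o, ho, hoB⟩ : ∃ o ∈ interior K, o ∉ B := by
    obtain ⟨c, hc⟩ := hi
    have hinf : (interior K).Infinite := infinite_of_mem_nhds c (isOpen_interior.mem_nhds hc)
    obtain ⟨o, h1, h2⟩ := (hinf.sdiff hBfin).nonempty
    exact ⟨o, h1, h2⟩
  have hoK := interior_subset ho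
  have hgood : ∀ x ∈ K, x ∉ B → up x ∉ G.corners ∧ low x ∉ G.corners := by
    intro x hx hxB
    exact ⟨fun h => hxB (Or.inl ⟨hx, h⟩), fun h => hxB (Or.inr ⟨hx, h⟩)⟩
  obtain ⟨τ, hτ⟩ := hdev up hup o hoK (hgood o hoK hoB).1
  obtain ⟨κ, hκ⟩ := hdev low hlow o hoK (hgood o hoK hoB).2
  refine ⟨τ, κ, fun u h he => ?_⟩
  obtain ⟨hu, hle, a, haK, b, hbK, hab, ha, hb⟩ := he
  have hlt : ∀ x ∈ interior K, dot u x < h := fun x hx =>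
    dot_lt_of_mem_interior (by rw [hu]; exact one_pos) hle hx
  obtain ⟨p, hp, hpB⟩ := exists_segment_disjoint hab ha hb (hlt o ho).ne hBfin hoB
  have hseg : ∀ x ∈ segment ℝ a b, x ∈ K := fun x hx => hK.segment_subset haK hbK hx
  have hop : ∀ x ∈ segment ℝ o p, x ∈ K := fun x hx =>
    hK.segment_subset hoK (hseg p hp) hx
  have hglue : ∀ x ∈ segment ℝ a b, up x = low x := by
    intro x hx
    refine hfr x (hseg x hx) ⟨subset_closure (hseg x hx), fun hxi => ?_⟩
    exact (hlt x hxi).ne (dot_eq_of_mem_segment ha hb hx)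
  have hpK := hseg p hp
  obtain ⟨ε, hε, ψ, h1, h2⟩ := SquareGluing.exists_chart (up p)
    (hgood p hpK (hpB p (right_mem_segment ℝ o p))).1
  obtain ⟨τ', hψτ, hτ'⟩ := hchart up hup p hpK ε hε ψ h1 h2
  -- Both sheets pass through the same surface point over `p`, so one chart serves for both.
  rw [hglue p hp] at h1 h2
  obtain ⟨κ', hψκ, hκ'⟩ := hchart low hlow p hpK ε hε ψ h1 h2
  obtain ⟨w₁, hw₁, e₁⟩ := hτ.along_segment hK hi hoK hpK
    (fun z hz => hdev up hup z (hop z hz) (hgood z (hop z hz) (hpB z hz)).1) hτ'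
  obtain ⟨w₂, hw₂, e₂⟩ := hκ.along_segment hK hi hoK hpK
    (fun z hz => hdev low hlow z (hop z hz) (hgood z (hop z hz) (hpB z hz)).2) hκ'
  obtain ⟨p', hp', hpp', hd'⟩ := exists_mem_segment_near hab hp hε
  have hfix : ∀ y ∈ segment ℝ a b, dist y p < ε → (τ'⁻¹ * κ') y = y := by
    intro y hy hd
    rw [AffineIsometryEquiv.coe_mul, Function.comp_apply, ← hψκ y (hseg y hy) hd, ← hglue y hy,
      hψτ y (hseg y hy) hd, AffineIsometryEquiv.coe_inv, AffineIsometryEquiv.symm_apply_apply]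
  -- Otherwise the chart, which is injective, would send the two sheets over some interior point
  -- near `p` to the same position.
  have hne1 : τ'⁻¹ * κ' ≠ 1 := by
    intro h
    have hEq : κ' = τ' := (inv_mul_eq_one.1 h).symm
    obtain ⟨y, hy, hd⟩ := exists_interior_inter_ball hK hi hpK hε
    have hyK := interior_subset hy
    apply hint y hy
    have e : ψ (up y) = ψ (low y) := by rw [hψτ y hyK hd, hψκ y hyK hd, hEq]
    have hd1 : edist y p < ENNReal.ofReal ε := by
      rw [edist_dist]
      exact (ENNReal.ofReal_lt_ofReal_iff hε).2 hd
    have h3 := h1 (up y) (low y) (by rw [← hglue p hp, hup y hyK p hpK]; exact hd1)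
      (by rw [hlow y hyK p hpK]; exact hd1)
    rw [e, edist_self] at h3
    exact edist_eq_zero.1 h3.symm
  refine ⟨w₂⁻¹ * w₁, latticeGroup.mul_mem (latticeGroup.inv_mem hw₂) hw₁, fun x => ?_⟩
  rw [← eq_reflect hu hpp'.symm (dot_eq_of_mem_segment ha hb hp) (dot_eq_of_mem_segment ha hb hp')
    (hfix p hp (by rwa [dist_self])) (hfix p' hp' hd') hne1 x]
  have : κ = w₂⁻¹ * w₁ * τ * (τ'⁻¹ * κ') := by
    rw [e₁, e₂]
    group
  exact congrArg (fun σ : Plane ≃ᵃⁱ[ℝ] Plane => σ x) this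

/-! ### Moving the polygon into the lattice plane -/

theorem volume_image_affineIsometryEquiv (τ : Plane ≃ᵃⁱ[ℝ] Plane) (s : Set Plane) :
    volume (τ '' s) = volume s := by
  have h := τ.toIsometryEquiv.isometry.euclideanHausdorffMeasure_image (d := 2) s
  rwa [EuclideanSpace.euclideanHausdorffMeasure_eq_volume] at h

namespace ConvexPolygon

/-- The image of a polygon under an isometry. -/
noncomputable def map (P : ConvexPolygon) (τ : Plane ≃ᵃⁱ[ℝ] Plane) : ConvexPolygon where
  carrier := τ '' P.carrier
  exists_vertices := by
    classical
    obtain ⟨V, hV⟩ := P.exists_vertices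
    refine ⟨V.image τ, ?_⟩
    rw [hV, Finset.coe_image]
    exact τ.toAffineEquiv.toAffineMap.image_convexHull _
  nonempty_interior := by
    have h := τ.toHomeomorph.image_interior P.carrier
    rw [show (τ : Plane → Plane) '' P.carrier = τ.toHomeomorph '' P.carrier from rfl, ← h]
    exact P.nonempty_interior.image _

theorem congruence_map (P : ConvexPolygon) (τ : Plane ≃ᵃⁱ[ℝ] Plane) :
    congruence P (P.map τ) := ⟨τ.toIsometryEquiv, rfl⟩

end ConvexPolygon

/-- An isometry conjugates reflections to reflections; the normal is pulled back by the linear part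
and the offset changes accordingly. -/
theorem exists_dot_eq_dot_map (τ : Plane ≃ᵃⁱ[ℝ] Plane) {u : Plane} (hu : dot u u = 1) (h : ℝ) :
    ∃ u' h', dot u' u' = 1 ∧ (∀ x, dot u (τ x) - h = dot u' x - h') ∧
      ∀ x, τ (reflect u' h' x) = reflect u h (τ x) := by
  set L := τ.linearIsometryEquiv with hL
  have hτ : ∀ x y, τ (x + y) = τ x + L y := by
    intro x y
    have := τ.map_vadd x y
    rwa [vadd_eq_add, vadd_eq_add, add_comm, add_comm (L y)] at this
  have hLu : L (L.symm u) = u := L.apply_symm_apply u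
  have hd : ∀ x, dot u (τ x) = dot (L.symm u) x + dot u (τ 0) := by
    intro x
    have h1 : τ x = τ 0 + L x := by rw [← hτ, zero_add]
    rw [h1, dot_add, dot_eq_inner u (L x), dot_eq_inner (L.symm u) x, add_comm]
    congr 1
    rw [← L.inner_map_map (L.symm u), hLu]
  refine ⟨L.symm u, h - dot u (τ 0), ?_, fun x => ?_, fun x => ?_⟩
  · rw [dot_eq_inner, L.symm.inner_map_map, ← dot_eq_inner, hu]
  · rw [hd x]
    ring
  · unfold reflect
    rw [sub_eq_add_neg, hτ, ← smul_neg, L.map_smul, map_neg, hLu, hd x]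
    module

/-- A polygon whose double is glued from squares has a copy such that the products of the
reflections in its edges preserve the square lattice. -/
theorem ConvexPolygon.GluableFrom.exists_congruent {P : ConvexPolygon} {m : ℕ}
    (h : P.GluableFrom m) :
    ∃ Q : ConvexPolygon, congruence P Q ∧ volume Q.carrier ≤ m ∧
      ∀ u h u' h', IsEdgeLine Q.carrier u h → IsEdgeLine Q.carrier u' h' →
        ∀ z ∈ intLattice, reflect u h (reflect u' h' z) ∈ intLattice := by
  have hvol := P.volume_carrier_le h
  obtain ⟨G, ⟨f⟩⟩ := h
  obtain ⟨up, low, hup, hlow, hfr, hint⟩ := P.exists_sheets f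
  obtain ⟨τ, κ, hτ⟩ := exists_developments P.convex P.nonempty_interior hup hlow
    (fun x _ hx => hfr x hx) hint
  refine ⟨P.map τ, P.congruence_map τ, (volume_image_affineIsometryEquiv τ _).trans_le hvol, ?_⟩
  have key : ∀ u h, IsEdgeLine (P.map τ).carrier u h →
      ∃ w ∈ latticeGroup, ∀ y, κ (τ.symm y) = w (reflect u h y) := by
    intro u h he
    obtain ⟨u', h', hu', hd, hr⟩ := exists_dot_eq_dot_map τ he.unit h
    have he' : IsEdgeLine P.carrier u' h' := by
      refine ⟨hu', fun x hx => ?_, ?_⟩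
      · have := he.le (τ x) ⟨x, hx, rfl⟩
        have := hd x
        linarith
      · obtain ⟨_, ⟨a, ha, rfl⟩, _, ⟨b, hb, rfl⟩, hab, e, e'⟩ := he.exists_ne
        refine ⟨a, ha, b, hb, fun h => hab (by rw [h]), ?_, ?_⟩
        · have := hd a
          linarith
        · have := hd b
          linarith
    obtain ⟨w, hw, e⟩ := hτ u' h' he'
    refine ⟨w, hw, fun y => ?_⟩
    rw [e, hr, τ.apply_symm_apply]
  intro u h u' h' he he' z hz
  obtain ⟨w, hw, e⟩ := key u h he
  obtain ⟨w', hw', e'⟩ := key u' h' he'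
  -- Evaluating `κ ∘ τ⁻¹` at the mirror image of `z` through both edges gives `w (r r' z) = w' z`,
  -- free of `κ`.
  have h1 := e' (reflect u' h' z)
  rw [e, reflect_reflect he'.unit] at h1
  exact (hw _).1 (h1 ▸ (hw' z).2 hz)

/-! ### A polygon is cut out by its edge lines -/

theorem exists_eq_dot (f : Plane →L[ℝ] ℝ) : ∃ u, ∀ x, f x = dot u x := by
  refine ⟨!₂[f (EuclideanSpace.single 0 1), f (EuclideanSpace.single 1 1)], fun x => ?_⟩
  have hx : x = x 0 • EuclideanSpace.single 0 (1 : ℝ) + x 1 • EuclideanSpace.single 1 (1 : ℝ) := by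
    refine plane_ext ?_ ?_ <;> simp
  conv_lhs => rw [hx]
  rw [map_add, map_smul, map_smul, smul_eq_mul, smul_eq_mul]
  simp [dot]
  ring

theorem dot_self_pos {u : Plane} (hu : u ≠ 0) : 0 < dot u u := by
  rw [dot_eq_inner]
  exact real_inner_self_pos.2 hu

/-- A polygon is the intersection of the half-planes of its edge lines. -/
theorem ConvexPolygon.exists_isEdgeLine_lt (P : ConvexPolygon) {x : Plane} (hx : x ∉ P.carrier) :
    ∃ u h, IsEdgeLine P.carrier u h ∧ h < dot u x := by
  obtain ⟨V, hV⟩ := P.exists_vertices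
  have hVP : (V : Set Plane) ⊆ P.carrier := hV ▸ subset_convexHull ℝ _
  have hxV : x ∉ (V : Set Plane) := fun h => hx (hVP h)
  -- With `p` on a short interior segment across the direction of `x`, the segment from `x` to `p`
  -- can be made to miss all points of `V`, so it enters the polygon at some `z` outside `V`.
  obtain ⟨p, hp, hpV⟩ : ∃ p ∈ interior P.carrier, ∀ z ∈ segment ℝ x p, z ∉ (V : Set Plane) := by
    obtain ⟨c, hc⟩ := P.nonempty_interior
    have hxc : x - c ≠ 0 := by
      rw [sub_ne_zero]
      rintro rfl
      exact hx (interior_subset hc)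
    set u := x - c with hu
    have hupos := dot_self_pos hxc
    let v : Plane := !₂[-u 1, u 0]
    have huv : dot u v = 0 := by
      simp [dot, v]
      ring
    have hv : v ≠ 0 := by
      intro h
      apply hxc
      have h0 := congrArg (fun w : Plane => w 0) h
      have h1 := congrArg (fun w : Plane => w 1) h
      simp only [v] at h0 h1
      exact plane_ext (by simpa using h1) (by simpa using h0)
    obtain ⟨δ, hδ, hb⟩ : ∃ δ : ℝ, 0 < δ ∧ c + δ • v ∈ interior P.carrier := by
      have hcont : Continuous fun t : ℝ => c + t • v := by fun_prop
      have h0 := hcont.tendsto 0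
      simp only [zero_smul, add_zero] at h0
      have h1 := (h0.mono_left (nhdsWithin_le_nhds (s := Set.Ioi 0))).eventually
        (isOpen_interior.mem_nhds hc)
      obtain ⟨t, ht, ht0⟩ := (h1.and self_mem_nhdsWithin).exists
      exact ⟨t, ht0, ht⟩
    have hxh : dot u x ≠ dot u c := by
      have : dot u x - dot u c = dot u u := by rw [← dot_sub]
      intro h
      rw [h, sub_self] at this
      exact hupos.ne this
    obtain ⟨p, hp, hpV⟩ := exists_segment_disjoint (u := u) (a := c) (b := c + δ • v) (o := x)
      (h := dot u c) (fun h => smul_ne_zero hδ.ne' hv (left_eq_add.1 h)) rfl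
      (by rw [dot_add, dot_smul, huv, mul_zero, add_zero]) hxh V.finite_toSet hxV
    exact ⟨p, P.convex.interior.segment_subset hc hb hp, hpV⟩
  obtain ⟨z, hz, hzf⟩ : (segment ℝ x p ∩ frontier P.carrier).Nonempty := by
    by_contra hcon
    have hsub : segment ℝ x p ⊆ interior P.carrier ∪ P.carrierᶜ := by
      intro y hy
      by_contra h
      rw [Set.mem_union, not_or, Set.notMem_compl_iff] at h
      exact hcon ⟨y, hy, subset_closure h.2, h.1⟩
    obtain ⟨y, -, hy, hy'⟩ := (convex_segment x p).isPreconnected _ _ isOpen_interior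
      P.isClosed.isOpen_compl hsub ⟨p, right_mem_segment ℝ x p, hp⟩
      ⟨x, left_mem_segment ℝ x p, hx⟩
    exact hy' (interior_subset hy)
  have hzP := P.frontier_subset hzf
  obtain ⟨f, hf⟩ := geometric_hahn_banach_open_point P.convex.interior isOpen_interior hzf.2
  obtain ⟨u, hu⟩ := exists_eq_dot f
  simp only [hu] at hf
  have hle : ∀ y ∈ P.carrier, dot u y ≤ dot u z := by
    intro y hy
    have hcl : y ∈ closure (interior P.carrier) := by
      rw [P.convex.closure_interior_eq_closure_of_nonempty_interior P.nonempty_interior]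
      exact subset_closure hy
    exact closure_minimal (fun a ha => (hf a ha).le)
      (isClosed_le (continuous_dot u) continuous_const) hcl
  -- A supporting line at `z` must contain a point of `V`, since otherwise the whole hull would lie
  -- strictly on one side. As this point is not `z`, the line is an edge line.
  obtain ⟨v, hvV, hvz⟩ : ∃ v ∈ V, dot u v = dot u z := by
    by_contra! hcon
    have hsub : P.carrier ⊆ {y | f y < f z} := by
      rw [hV]
      refine convexHull_min (fun v hv => ?_)
        (convex_halfSpace_lt f.toLinearMap.isLinear _)
      show f v < f z
      rw [hu, hu]
      exact (hle v (hVP hv)).lt_of_ne (hcon v hv)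
    exact lt_irrefl (f z) (hsub hzP)
  have hvz' : v ≠ z := by
    rintro rfl
    exact hpV v hz hvV
  have hlt : dot u z < dot u x := by
    by_contra! hcon
    obtain ⟨s, t, hs, ht, hst, rfl⟩ := hz
    have h1 := hf p hp
    rcases ht.eq_or_lt with h0 | h0
    · subst h0
      have : s = 1 := by linarith
      rw [this] at hzP
      simp only [one_smul, zero_smul, add_zero] at hzP
      exact hx hzP
    · set d := dot u (s • x + t • p) with hd
      have h2 : d = s * dot u x + t * dot u p := by rw [hd, dot_add, dot_smul, dot_smul]
      have h3 : s * dot u x ≤ s * d := mul_le_mul_of_nonneg_left hcon hs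
      have h4 : t * dot u p < t * d := mul_lt_mul_of_pos_left h1 h0
      have h5 : s * d + t * d = d := by rw [← add_mul, hst, one_mul]
      linarith
  have hu0 : 0 < dot u u := by
    apply dot_self_pos
    rintro rfl
    simp [dot] at hlt
  set n := (Real.sqrt (dot u u))⁻¹ with hn
  have hn0 : 0 < n := inv_pos.2 (Real.sqrt_pos.2 hu0)
  have hdot : ∀ y, dot (n • u) y = n * dot u y := by
    intro y
    simp [dot]
    ring
  refine ⟨n • u, n * dot u z, ⟨?_, fun y hy => ?_, z, hzP, v, hVP hvV, hvz'.symm, hdot z, ?_⟩, ?_⟩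
  · rw [hdot, dot_smul, ← mul_assoc, ← sq, hn, inv_pow, Real.sq_sqrt hu0.le, inv_mul_cancel₀ hu0.ne']
  · rw [hdot]
    exact mul_le_mul_of_nonneg_left (hle y hy) hn0.le
  · rw [hdot, hvz]
  · rw [hdot]
    exact mul_lt_mul_of_pos_left hlt hn0

/-! ### Products of two reflections in the lattice group -/

section ReflectionPairs

variable {u v : Plane} {h k : ℝ}

/-- The product of the reflections is a rotation by twice the angle between the normals, composed
with a translation: `2c² - 1` and `2cs` are the cosine and sine of the doubled angle. -/
theorem reflect_reflect_apply (hu : dot u u = 1) (hv : dot v v = 1) (z : Plane) :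
    reflect u h (reflect v k z) 0 = (2 * dot u v ^ 2 - 1) * z 0 -
      2 * dot u v * (u 1 * v 0 - u 0 * v 1) * z 1 + (2 * k * v 0 + 2 * (h - 2 * k * dot u v) * u 0) ∧
    reflect u h (reflect v k z) 1 = 2 * dot u v * (u 1 * v 0 - u 0 * v 1) * z 0 +
      (2 * dot u v ^ 2 - 1) * z 1 + (2 * k * v 1 + 2 * (h - 2 * k * dot u v) * u 1) := by
  have key : ∀ a b c d x y : ℝ, a * a + b * b = 1 → c * c + d * d = 1 →
      x - 2 * (c * x + d * y - k) * c - 2 * (a * (x - 2 * (c * x + d * y - k) * c) +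
        b * (y - 2 * (c * x + d * y - k) * d) - h) * a =
      (2 * (a * c + b * d) ^ 2 - 1) * x - 2 * (a * c + b * d) * (b * c - a * d) * y +
        (2 * k * c + 2 * (h - 2 * k * (a * c + b * d)) * a) := by
    intro a b c d x y h1 h2
    grind
  refine ⟨key _ _ _ _ _ _ hu hv, ?_⟩
  have h1 := key (u 1) (u 0) (v 1) (v 0) (z 1) (z 0) (by rw [← hu, dot, add_comm])
    (by rw [← hv, dot, add_comm])
  simp only [reflect, dot, PiLp.sub_apply, PiLp.smul_apply, smul_eq_mul]
  linear_combination h1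

theorem zero_mem_intLattice : (0 : Plane) ∈ intLattice := fun _ => ⟨0, by simp⟩

theorem single_mem_intLattice : (!₂[1, 0] : Plane) ∈ intLattice :=
  intLattice_iff.2 ⟨⟨1, by simp⟩, 0, by simp⟩

theorem cross_sq (hu : dot u u = 1) (hv : dot v v = 1) :
    (u 1 * v 0 - u 0 * v 1) ^ 2 = 1 - dot u v ^ 2 := by
  have key : ∀ a b c d : ℝ, a * a + b * b = 1 → c * c + d * d = 1 →
      (b * c - a * d) ^ 2 = 1 - (a * c + b * d) ^ 2 := by
    intro a b c d h1 h2
    grind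
  exact key _ _ _ _ hu hv

variable (hu : dot u u = 1) (hv : dot v v = 1)
  (hT : ∀ z ∈ intLattice, reflect u h (reflect v k z) ∈ intLattice)

include hu hv hT

/-- Applied to lattice points, the rotation part must be integral, so `2c² - 1` is -1, 0 or 1: the
lines meet at a multiple of 45 degrees. -/
theorem dot_cases : dot u v = 0 ∨ dot u v ^ 2 = 1 ∨ 2 * dot u v ^ 2 = 1 := by
  have h0 := hT _ zero_mem_intLattice
  have h1 := hT _ single_mem_intLattice
  rw [intLattice_iff, (reflect_reflect_apply hu hv _).1, (reflect_reflect_apply hu hv _).2] at h0 h1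
  obtain ⟨⟨a, ha⟩, -⟩ := h0
  obtain ⟨⟨b, hb⟩, -⟩ := h1
  simp only [PiLp.zero_apply, mul_zero] at ha
  simp at hb
  have e : 2 * dot u v ^ 2 = ((b - a + 1 : ℤ) : ℝ) := by
    push_cast
    linarith
  have hs := cross_sq hu hv
  have hle : dot u v ^ 2 ≤ 1 := by
    have := sq_nonneg (u 1 * v 0 - u 0 * v 1)
    linarith
  have h0 : (0 : ℤ) ≤ b - a + 1 := by
    have : (0 : ℝ) ≤ ((b - a + 1 : ℤ) : ℝ) := by rw [← e]; positivity
    exact_mod_cast this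
  have h2 : b - a + 1 ≤ (2 : ℤ) := by
    have : ((b - a + 1 : ℤ) : ℝ) ≤ 2 := by rw [← e]; linarith
    exact_mod_cast this
  generalize b - a + 1 = n at *
  interval_cases n
  · left
    have : dot u v ^ 2 = 0 := by simpa using e
    exact pow_eq_zero_iff (two_ne_zero) |>.1 this
  · right; right
    simpa using e
  · right; left
    have : 2 * dot u v ^ 2 = 2 := by simpa using e
    linarith

/-- Two lines that are not parallel meet in a half-integer point. -/
theorem two_smul_mem_intLattice (hp : dot u v ^ 2 ≠ 1) {x : Plane} (hx : dot u x = h)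
    (hx' : dot v x = k) : (2 : ℝ) • x ∈ intLattice := by
  have h0 := hT _ zero_mem_intLattice
  have h1 := hT _ single_mem_intLattice
  rw [intLattice_iff, (reflect_reflect_apply hu hv _).1, (reflect_reflect_apply hu hv _).2] at h0 h1
  obtain ⟨⟨a, ha⟩, b, hb⟩ := h0
  obtain ⟨⟨a', ha'⟩, b', hb'⟩ := h1
  have f0 := (reflect_reflect_apply (h := h) (k := k) hu hv x).1
  have f1 := (reflect_reflect_apply (h := h) (k := k) hu hv x).2
  -- The meeting point is the centre of the rotation, whose angle is 180 or ±90 degrees. Solving the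
  -- fixed point equation with integral data costs at most a denominator 2.
  have hfix : reflect u h (reflect v k x) = x := by simp [reflect, hx, hx']
  rw [hfix] at f0 f1
  have hcr := cross_sq hu hv
  have hc := dot_cases hu hv hT
  set c := dot u v
  set s := u 1 * v 0 - u 0 * v 1
  simp at ha hb ha' hb'
  rw [intLattice_iff]
  rcases hc with hc | hc | hc
  · rw [hc] at f0 f1 ha hb
    refine ⟨⟨a, ?_⟩, b, ?_⟩ <;> simp at f0 f1 ha hb ⊢ <;> linarith
  · exact absurd hc hp
  · have hb2 : (2 * c * s) = ((b' - b : ℤ) : ℝ) := by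
      push_cast
      linarith
    have hs : 2 * s ^ 2 = 1 := by linarith
    have hsq : (2 * c * s) ^ 2 = 1 := by
      linear_combination (2 * s ^ 2) * hc + hs
    rw [hb2] at hsq f0 f1
    set n := b' - b
    refine ⟨⟨a - n * b, ?_⟩, b + n * a, ?_⟩
    · simp
      linear_combination f0 - n * f1 + ha - n * hb - (x 0) * hsq + (x 0 - n * x 1) * hc
    · simp
      linear_combination f1 + n * f0 + hb + n * ha - (x 1) * hsq + (x 1 + n * x 0) * hc

/-- The distance vector of two parallel lines is half-integer. -/
theorem smul_mem_intLattice (hp : dot u v ^ 2 = 1) :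
    (2 * (dot u v * h - k)) • v ∈ intLattice := by
  have h0 := hT _ zero_mem_intLattice
  have hcr := cross_sq hu hv
  rw [hp, sub_self] at hcr
  have hcr' : u 1 * v 0 - u 0 * v 1 = 0 := pow_eq_zero_iff two_ne_zero |>.1 hcr
  have e0 : u 0 = dot u v * v 0 := by
    unfold dot at *
    linear_combination (-(u 0)) * hv - v 1 * hcr'
  have e1 : u 1 = dot u v * v 1 := by
    unfold dot at *
    linear_combination (-(u 1)) * hv + v 0 * hcr'
  -- For parallel lines the product is a translation, whose vector is the image of the origin.
  have e : reflect u h (reflect v k 0) = (2 * (dot u v * h - k)) • v := by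
    refine plane_ext ?_ ?_
    · rw [(reflect_reflect_apply hu hv _).1]
      simp
      linear_combination 2 * (h - 2 * k * dot u v) * e0 - 4 * k * v 0 * hp
    · rw [(reflect_reflect_apply hu hv _).2]
      simp
      linear_combination 2 * (h - 2 * k * dot u v) * e1 - 4 * k * v 1 * hp
  rwa [e] at h0

end ReflectionPairs

/-! ### Vertices and edges of the polygon -/

namespace ConvexPolygon

/-- Every linear form attains its maximum over a polygon at an extreme point. -/
theorem exists_extremePoint_max (P : ConvexPolygon) (n : Plane) :
    ∃ x ∈ P.carrier.extremePoints ℝ, ∀ y ∈ P.carrier, dot n y ≤ dot n x := by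
  have hexp : IsExposed ℝ P.carrier {x ∈ P.carrier | ∀ y ∈ P.carrier, dot n y ≤ dot n x} := by
    intro _
    refine ⟨innerSL ℝ n, ?_⟩
    simp only [innerSL_apply_apply, dot_eq_inner]
  obtain ⟨o, ho⟩ := P.nonempty_interior
  obtain ⟨z, hz, hz'⟩ := P.isCompact.exists_isMaxOn ⟨o, interior_subset ho⟩
    (continuous_dot n).continuousOn
  obtain ⟨x, hx⟩ := (hexp.isCompact P.isCompact).extremePoints_nonempty ⟨z, hz, hz'⟩
  exact ⟨x, hexp.isExtreme.extremePoints_subset_extremePoints hx, hx.1.2⟩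

/-- An edge line contains two extreme points. -/
theorem exists_extremePoints_of_isEdgeLine (P : ConvexPolygon) {u : Plane} {h : ℝ}
    (he : IsEdgeLine P.carrier u h) :
    ∃ a ∈ P.carrier.extremePoints ℝ, ∃ b ∈ P.carrier.extremePoints ℝ, a ≠ b ∧ dot u a = h ∧
      dot u b = h := by
  obtain ⟨hu, hle, a, ha, b, hb, hab, hah, hbh⟩ := he
  set F := {x ∈ P.carrier | ∀ y ∈ P.carrier, dot u y ≤ dot u x} with hF
  have hexp : IsExposed ℝ P.carrier F := by
    intro _
    refine ⟨innerSL ℝ u, ?_⟩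
    simp only [hF, innerSL_apply_apply, dot_eq_inner]
  have hmem : ∀ x ∈ P.carrier, dot u x = h → x ∈ F := fun x hx e =>
    ⟨hx, fun y hy => (hle y hy).trans e.ge⟩
  have hFh : ∀ x ∈ F, dot u x = h := fun x hx =>
    le_antisymm (hle x hx.1) (hah ▸ hx.2 a ha)
  have hcl := closure_convexHull_extremePoints (hexp.isCompact P.isCompact) (hexp.convex P.convex)
  obtain ⟨x, hx⟩ := (hexp.isCompact P.isCompact).extremePoints_nonempty ⟨a, hmem a ha hah⟩
  by_contra! hcon
  have hext := hexp.isExtreme.extremePoints_subset_extremePoints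
  have hsub : F.extremePoints ℝ ⊆ {x} := by
    intro y hy
    by_contra hne
    exact hcon y (hext hy) x (hext hx) hne (hFh y hy.1) (hFh x hx.1)
  have hsub' : F ⊆ {x} := by
    rw [← hcl]
    refine closure_minimal (convexHull_min hsub (convex_singleton x)) isClosed_singleton
  exact hab ((hsub' (hmem a ha hah)).trans (hsub' (hmem b hb hbh)).symm)

variable {Q : ConvexPolygon}
  (hQ : ∀ u h u' h', IsEdgeLine Q.carrier u h → IsEdgeLine Q.carrier u' h' →
    ∀ z ∈ intLattice, reflect u h (reflect u' h' z) ∈ intLattice)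

theorem exists_isEdgeLine (Q : ConvexPolygon) : ∃ u h, IsEdgeLine Q.carrier u h := by
  obtain ⟨x, hx⟩ : ∃ x, x ∉ Q.carrier := by
    by_contra! h
    have := Q.isCompact
    rw [Set.eq_univ_of_forall h] at this
    exact noncompact_univ Plane this
  obtain ⟨u, h, he, -⟩ := Q.exists_isEdgeLine_lt hx
  exact ⟨u, h, he⟩

include hQ in
-- Cosine and sine of the angle to one fixed edge normal take finitely many values and determine the
-- normal, which in turn determines its support number.
theorem finite_isEdgeLine : {e : Plane × ℝ | IsEdgeLine Q.carrier e.1 e.2}.Finite := by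
  obtain ⟨v, k, hv⟩ := Q.exists_isEdgeLine
  let C : Set ℝ := {c | c = 0 ∨ c ^ 2 = 1 ∨ 2 * c ^ 2 = 1}
  have hC : C.Finite := by
    refine (Set.toFinite ({0, 1, -1, √(1 / 2), -√(1 / 2)} : Set ℝ)).subset ?_
    rintro c (h | h | h)
    · simp [h]
    · rcases (sq_eq_sq_iff_eq_or_eq_neg (b := (1 : ℝ))).1 (by rw [h, one_pow]) with h | h <;> simp [h]
    · have : c ^ 2 = √(1 / 2) ^ 2 := by
        rw [Real.sq_sqrt (by norm_num)]
        linarith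
      rcases sq_eq_sq_iff_eq_or_eq_neg.1 this with h | h <;> simp [h]
  refine Set.Finite.of_finite_image ((hC.prod hC).subset ?_)
    (f := fun e : Plane × ℝ => (dot e.1 v, e.1 1 * v 0 - e.1 0 * v 1)) ?_
  · rintro _ ⟨⟨u, h⟩, he, rfl⟩
    have h1 := dot_cases he.unit hv.unit (hQ _ _ _ _ he hv)
    have h2 := cross_sq he.unit hv.unit
    refine ⟨h1, ?_⟩
    rcases h1 with h1 | h1 | h1
    · right; left
      rw [h2, h1]
      norm_num
    · left
      rw [h1, sub_self] at h2
      exact pow_eq_zero_iff two_ne_zero |>.1 h2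
    · right; right
      rw [h2]
      linarith
  · rintro ⟨u, h⟩ he ⟨u', h'⟩ he' heq
    obtain ⟨e1, e2⟩ := Prod.mk.inj heq
    have hvu := hv.unit
    have huu : u = u' := by
      unfold dot at *
      simp only at e1 e2
      refine plane_ext ?_ ?_
      · linear_combination (-(u 0 - u' 0)) * hvu + v 0 * e1 - v 1 * e2
      · linear_combination (-(u 1 - u' 1)) * hvu + v 1 * e1 + v 0 * e2
    subst huu
    obtain ⟨-, hle, a, ha, -, -, -, hah, -⟩ := he
    obtain ⟨-, hle', a', ha', -, -, -, hah', -⟩ := he'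
    simp only at *
    rw [Prod.mk.injEq]
    exact ⟨rfl, le_antisymm (hah ▸ hle' a ha) (hah' ▸ hle a' ha')⟩

include hQ in
/-- An extreme point of the polygon lies on two edge lines that are not parallel. -/
theorem exists_isEdgeLine_of_extremePoint {x : Plane} (hx : x ∈ Q.carrier.extremePoints ℝ) :
    ∃ u h v k, IsEdgeLine Q.carrier u h ∧ IsEdgeLine Q.carrier v k ∧ dot u x = h ∧ dot v x = k ∧
      dot u v ^ 2 ≠ 1 := by
  by_contra! hcon
  -- If all edge lines through `x` are parallel, or there are none, `d` is a direction along them.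
  -- The other edge lines are finitely many and have slack, so `x` can be moved both ways along `d`,
  -- which contradicts extremality.
  obtain ⟨d, hd0, hd⟩ : ∃ d : Plane, d ≠ 0 ∧
      ∀ u h, IsEdgeLine Q.carrier u h → dot u x = h → dot u d = 0 := by
    by_cases hex : ∃ v k, IsEdgeLine Q.carrier v k ∧ dot v x = k
    · obtain ⟨v, k, hv, hvx⟩ := hex
      refine ⟨!₂[-v 1, v 0], fun h => ?_, fun u h hu hux => ?_⟩
      · have h0 := congrArg (fun w : Plane => w 0) h
        have h1 := congrArg (fun w : Plane => w 1) h
        simp at h0 h1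
        have := hv.unit
        simp [dot, h0, h1] at this
      · have h1 := cross_sq hu.unit hv.unit
        rw [hcon u h v k hu hv hux hvx, sub_self] at h1
        have h2 := pow_eq_zero_iff two_ne_zero |>.1 h1
        simp only [dot]
        simp
        linarith
    · push Not at hex
      refine ⟨!₂[1, 0], fun h => ?_, fun u h hu hux => absurd hux (hex u h hu)⟩
      have h0 := congrArg (fun w : Plane => w 0) h
      simp at h0
  have hev : ∀ᶠ t in nhds (0 : ℝ), x + t • d ∈ Q.carrier := by
    have h1 : ∀ᶠ t in nhds (0 : ℝ), ∀ e ∈ {e : Plane × ℝ | IsEdgeLine Q.carrier e.1 e.2},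
        dot e.1 (x + t • d) ≤ e.2 := by
      rw [Filter.eventually_all_finite (finite_isEdgeLine hQ)]
      rintro ⟨u, h⟩ he
      rcases (he.le x hx.1).eq_or_lt with h0 | h0
      · refine Filter.Eventually.of_forall fun t => ?_
        simp only at *
        rw [dot_add, dot_smul, hd u h he h0, mul_zero, add_zero, h0]
      · have hcont : Continuous fun t : ℝ => dot u (x + t • d) :=
          (continuous_dot u).comp (by fun_prop)
        have h2 := hcont.tendsto 0
        simp only [zero_smul, add_zero] at h2
        exact (h2.eventually (gt_mem_nhds h0)).mono fun t ht => ht.le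
    refine h1.mono fun t ht => ?_
    by_contra hn
    obtain ⟨u, h, he, hlt⟩ := Q.exists_isEdgeLine_lt hn
    exact absurd (ht (u, h) he) (not_le.2 hlt)
  have hev' : ∀ᶠ t in nhds (0 : ℝ), x + (-t) • d ∈ Q.carrier := by
    have h0 : Filter.Tendsto (fun t : ℝ => -t) (nhds 0) (nhds 0) := by
      simpa using (continuous_neg (G := ℝ)).tendsto 0
    exact h0.eventually hev
  obtain ⟨t, ⟨ht, ht'⟩, ht0⟩ := ((hev.and hev').filter_mono
    (nhdsWithin_le_nhds (s := Set.Ioi 0))).and self_mem_nhdsWithin |>.exists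
  have hmem : x ∈ openSegment ℝ (x + t • d) (x + (-t) • d) :=
    ⟨1 / 2, 1 / 2, by norm_num, by norm_num, by norm_num, by module⟩
  have h3 := hx.2 ht ht' hmem
  rw [add_eq_left] at h3
  exact smul_ne_zero (ne_of_gt ht0) hd0 h3

end ConvexPolygon

/-! ### Octagons in an adapted frame -/

/-- The eight directions of the edges of an octagon. -/
structure IsOctDir (A B : ℤ) : Prop where
  neg_one_le_left : -1 ≤ A
  left_le_one : A ≤ 1
  neg_one_le_right : -1 ≤ B
  right_le_one : B ≤ 1
  ne : A ≠ 0 ∨ B ≠ 0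

/-- The linear forms whose level lines are the edges of an octagon. -/
def octForm (i : Fin 4) (w : Plane) : ℝ :=
  match i with
  | 0 => w 0
  | 1 => w 1
  | 2 => w 0 + w 1
  | 3 => w 1 - w 0

/-- `S` is a (possibly degenerate) octagon with edges in the eight directions, and `a`, `b` are its
support numbers. -/
structure IsIntOctagon (S : Set Plane) (a b : Fin 4 → ℤ) : Prop where
  mem_iff : ∀ w, w ∈ S ↔ ∀ i, a i ≤ octForm i w ∧ octForm i w ≤ b i
  exists_eq_left : ∀ i, ∃ w ∈ S, octForm i w = a i
  exists_eq_right : ∀ i, ∃ w ∈ S, octForm i w = b i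

/-- By Bézout, `r` is an integer combination of the two integral coordinates. -/
theorem exists_int_of_coprime {p q : ℤ} (hpq : Int.gcd p q = 1) {r : ℝ}
    (hr : r • (!₂[(p : ℝ), q] : Plane) ∈ intLattice) : ∃ k : ℤ, r = k := by
  obtain ⟨⟨a, ha⟩, b, hb⟩ := intLattice_iff.1 hr
  have h := Int.gcd_eq_gcd_ab p q
  rw [hpq] at h
  have h' : (1 : ℝ) = p * Int.gcdA p q + q * Int.gcdB p q := by exact_mod_cast h
  simp at ha hb
  refine ⟨a * Int.gcdA p q + b * Int.gcdB p q, ?_⟩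
  push_cast
  rw [← ha, ← hb]
  linear_combination r * h'

theorem sub_mem_intLattice {x y : Plane} (hx : x ∈ intLattice) (hy : y ∈ intLattice) :
    x - y ∈ intLattice := fun k => by
  obtain ⟨a, ha⟩ := hx k
  obtain ⟨b, hb⟩ := hy k
  exact ⟨a - b, by simp [ha, hb]⟩

namespace ConvexPolygon

variable {Q : ConvexPolygon}
  (hQ : ∀ u h u' h', IsEdgeLine Q.carrier u h → IsEdgeLine Q.carrier u' h' →
    ∀ z ∈ intLattice, reflect u h (reflect u' h' z) ∈ intLattice)

include hQ

/-- In coordinates adapted to a primitive lattice vector along an edge, all edges have equations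
with integer coefficients. -/
theorem exists_frame : ∃ (a : Plane) (p q : ℤ), 0 < p ^ 2 + q ^ 2 ∧
    ∀ u h, IsEdgeLine Q.carrier u h → ∃ A B k : ℤ, ∃ l : ℝ, IsOctDir A B ∧ 0 < l ∧
      dot u !₂[p, q] = 4 * l * A ∧ dot u !₂[-q, p] = 4 * l * B ∧
      h = dot u a + 2 * l * k := by
  obtain ⟨v, k, hv⟩ := Q.exists_isEdgeLine
  obtain ⟨a, ha, b, hb, hab, hak, hbk⟩ := Q.exists_extremePoints_of_isEdgeLine hv
  -- Vertices are half-integral, so twice the vector between two vertices on the edge line of `v` is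
  -- integral; dividing it by its gcd gives the primitive `(p, q)`.
  have hhalf : ∀ x ∈ Q.carrier.extremePoints ℝ, (2 : ℝ) • x ∈ intLattice := by
    intro x hx
    obtain ⟨u, h, u', h', hu, hu', hux, hux', hne⟩ := exists_isEdgeLine_of_extremePoint hQ hx
    exact two_smul_mem_intLattice hu.unit hu'.unit (hQ _ _ _ _ hu hu') hne hux hux'
  have ha2 := hhalf a ha
  have hd := sub_mem_intLattice (hhalf b hb) ha2
  obtain ⟨⟨m, hm⟩, n, hn⟩ := intLattice_iff.1 hd
  have hmn : 0 < Int.gcd m n := by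
    rw [Int.gcd_pos_iff]
    by_contra! hcon
    apply hab
    rw [hcon.1] at hm
    rw [hcon.2] at hn
    simp at hm hn
    exact plane_ext (by linarith) (by linarith)
  obtain ⟨p, q, hpq, hmp, hnq⟩ := Int.exists_gcd_one hmn
  set g : ℝ := (Int.gcd m n : ℝ) with hg
  have hg0 : 0 < g := Nat.cast_pos.2 hmn
  have hpqne : p ≠ 0 ∨ q ≠ 0 := by
    by_contra! h
    rw [h.1, h.2] at hpq
    simp at hpq
  have hN : 0 < p ^ 2 + q ^ 2 := by
    rcases hpqne with h | h
    · have := sq_pos_of_ne_zero h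
      positivity
    · have := sq_pos_of_ne_zero h
      positivity
  have hmR : (m : ℝ) = p * g := by rw [hg]; exact_mod_cast hmp
  have hnR : (n : ℝ) = q * g := by rw [hg]; exact_mod_cast hnq
  have hvg : v 0 * p + v 1 * q = 0 := by
    have h1 : dot v ((2 : ℝ) • b - (2 : ℝ) • a) = 0 := by
      rw [dot_sub, dot_smul, dot_smul, hak, hbk, sub_self]
    rw [dot, hm, hn, hmR, hnR] at h1
    have h2 : g * (v 0 * p + v 1 * q) = 0 := by linarith
    exact (mul_eq_zero.1 h2).resolve_left hg0.ne'
  have hNR : (0 : ℝ) < (p : ℝ) ^ 2 + (q : ℝ) ^ 2 := by exact_mod_cast hN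
  refine ⟨a, p, q, hN, fun u h hu => ?_⟩
  set N : ℝ := (p : ℝ) ^ 2 + (q : ℝ) ^ 2 with hNdef
  set α := u 0 * p + u 1 * q with hα
  set β := u 1 * p - u 0 * q with hβ
  set γ := v 1 * p - v 0 * q with hγ
  have hdα : dot u !₂[(p : ℝ), q] = α := by simp [dot, hα]
  have hdβ : dot u !₂[-(q : ℝ), p] = β := by simp [dot, hβ]; ring
  rw [hdα, hdβ]
  have hu1 := hu.unit
  have hv1 := hv.unit
  have hαβ : α ^ 2 + β ^ 2 = N := by
    unfold dot at hu1
    rw [hα, hβ, hNdef]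
    linear_combination ((p : ℝ) ^ 2 + (q : ℝ) ^ 2) * hu1
  have hγN : γ ^ 2 = N := by
    unfold dot at hv1
    rw [hγ, hNdef]
    linear_combination ((p : ℝ) ^ 2 + (q : ℝ) ^ 2) * hv1 - (v 0 * p + v 1 * q) * hvg
  have hv0' : N * v 0 = -q * γ := by
    rw [hγ, hNdef]
    linear_combination (p : ℝ) * hvg
  have hv1' : N * v 1 = p * γ := by
    rw [hγ, hNdef]
    linear_combination (q : ℝ) * hvg
  have hγ0 : γ ≠ 0 := by
    intro h0
    rw [h0] at hγN
    norm_num at hγN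
    exact hNR.ne hγN
  have hc : N * dot u v = β * γ := by
    unfold dot
    rw [hβ]
    linear_combination u 0 * hv0' + u 1 * hv1'
  have hc2 : N * dot u v ^ 2 = β ^ 2 := by
    have : N * (N * dot u v ^ 2 - β ^ 2) = 0 := by
      linear_combination (N * dot u v + β * γ) * hc + β ^ 2 * hγN
    have := (mul_eq_zero.1 this).resolve_left hNR.ne'
    linarith
  have hT := hQ _ _ _ _ hu hv
  -- An edge parallel to the first is located by its distance vector, any other by its intersection
  -- with the first edge line. Both times primitivity makes the parameter integral; `l` is then a
  -- quarter of the nonzero `|α|` or `|β|`.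
  by_cases hpar : dot u v ^ 2 = 1
  · have hβN : β ^ 2 = N := by rw [← hc2, hpar, mul_one]
    have hα0 : α = 0 := by
      have : α ^ 2 = 0 := by linarith
      exact pow_eq_zero_iff two_ne_zero |>.1 this
    have hβ0 : β ≠ 0 := by
      intro h0
      rw [h0] at hβN
      norm_num at hβN
      exact hNR.ne hβN
    have hmem := smul_mem_intLattice hu.unit hv.unit hT hpar
    set r := 2 * (dot u v * h - k) * (γ / N) with hr
    have hmem' : r • (!₂[((-q : ℤ) : ℝ), p] : Plane) ∈ intLattice := by
      convert! hmem using 1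
      refine plane_ext ?_ ?_
      · simp [hr]
        have : v 0 = -q * γ / N := by field_simp; linarith
        rw [this]
        ring
      · simp [hr]
        have : v 1 = p * γ / N := by field_simp; linarith
        rw [this]
        ring
    obtain ⟨j, hj⟩ := exists_int_of_coprime (by rw [Int.neg_gcd, Int.gcd_comm]; exact hpq) hmem'
    have hcsq : dot u v * dot u v = 1 := by rw [← sq, hpar]
    have hua : dot u a = dot u v * k := by
      have h1 := cross_sq hu.unit hv.unit
      rw [hpar, sub_self] at h1
      have h2 := pow_eq_zero_iff two_ne_zero |>.1 h1
      have e0 : u 0 = dot u v * v 0 := by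
        unfold dot at *
        linear_combination (-(u 0)) * hv1 - v 1 * h2
      have e1 : u 1 = dot u v * v 1 := by
        unfold dot at *
        linear_combination (-(u 1)) * hv1 + v 0 * h2
      have e2 : dot u a = u 0 * a 0 + u 1 * a 1 := rfl
      have e3 : k = v 0 * a 0 + v 1 * a 1 := hak.symm
      rw [e2, e3]
      linear_combination a 0 * e0 + a 1 * e1
    have hh : h = dot u a + β / 2 * j := by
      have h1 : β / 2 * j = dot u v * (dot u v * h - k) := by
        rw [← hj, hr]
        field_simp
        linear_combination (-(dot u v * h - k)) * hc
      rw [h1, hua]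
      linear_combination (-h) * hcsq
    rcases lt_or_gt_of_ne hβ0 with hneg | hpos
    · refine ⟨0, -1, -j, -β / 4, ⟨by norm_num, by norm_num, by norm_num, by norm_num, by norm_num⟩,
        by linarith, ?_, ?_, ?_⟩
      · rw [hα0]; simp
      · push_cast; ring
      · rw [hh]; push_cast; ring
    · refine ⟨0, 1, j, β / 4, ⟨by norm_num, by norm_num, by norm_num, by norm_num, by norm_num⟩,
        by linarith, ?_, ?_, ?_⟩
      · rw [hα0]; simp
      · push_cast; ring
      · rw [hh]; ring
  · have hα0 : α ≠ 0 := by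
      intro h0
      apply hpar
      rw [h0] at hαβ
      have : N * (dot u v ^ 2 - 1) = 0 := by
        rw [mul_sub, hc2]
        linarith
      have := (mul_eq_zero.1 this).resolve_left hNR.ne'
      linarith
    set t := (h - dot u a) / α with ht
    let x : Plane := a + t • !₂[(p : ℝ), q]
    have hux : dot u x = h := by
      rw [dot_add, dot_smul, hdα, ht, div_mul_cancel₀ _ hα0]
      ring
    have hvx : dot v x = k := by
      rw [dot_add, dot_smul, hak]
      simp [dot, hvg]
    have hx := sub_mem_intLattice (two_smul_mem_intLattice hu.unit hv.unit hT hpar hux hvx) ha2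
    have hx' : (2 * t) • (!₂[(p : ℝ), q] : Plane) ∈ intLattice := by
      convert! hx using 1
      simp only [x]
      module
    obtain ⟨j, hj⟩ := exists_int_of_coprime hpq hx'
    have hh : h = dot u a + α / 2 * j := by
      rw [← hj, ht]
      field_simp
      ring
    have hβα : β = 0 ∨ β = α ∨ β = -α := by
      rcases dot_cases hu.unit hv.unit hT with h1 | h1 | h1
      · left
        rw [h1] at hc2
        norm_num at hc2
        exact pow_eq_zero_iff two_ne_zero |>.1 hc2.symm
      · exact absurd h1 hpar
      · right
        refine sq_eq_sq_iff_eq_or_eq_neg.1 ?_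
        linear_combination N * h1 - 2 * hc2 - hαβ
    rcases lt_or_gt_of_ne hα0 with hneg | hpos
    · rcases hβα with h1 | h1 | h1
      · refine ⟨-1, 0, -j, -α / 4, ⟨by norm_num, by norm_num, by norm_num, by norm_num,
          by norm_num⟩, by linarith, ?_, ?_, ?_⟩
        · push_cast; ring
        · rw [h1]; simp
        · rw [hh]; push_cast; ring
      · refine ⟨-1, -1, -j, -α / 4, ⟨by norm_num, by norm_num, by norm_num, by norm_num,
          by norm_num⟩, by linarith, ?_, ?_, ?_⟩
        · push_cast; ring
        · rw [h1]; push_cast; ring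
        · rw [hh]; push_cast; ring
      · refine ⟨-1, 1, -j, -α / 4, ⟨by norm_num, by norm_num, by norm_num, by norm_num,
          by norm_num⟩, by linarith, ?_, ?_, ?_⟩
        · push_cast; ring
        · rw [h1]; push_cast; ring
        · rw [hh]; push_cast; ring
    · rcases hβα with h1 | h1 | h1
      · refine ⟨1, 0, j, α / 4, ⟨by norm_num, by norm_num, by norm_num, by norm_num,
          by norm_num⟩, by linarith, ?_, ?_, ?_⟩
        · push_cast; ring
        · rw [h1]; simp
        · rw [hh]; ring
      · refine ⟨1, 1, j, α / 4, ⟨by norm_num, by norm_num, by norm_num, by norm_num,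
          by norm_num⟩, by linarith, ?_, ?_, ?_⟩
        · push_cast; ring
        · rw [h1]; push_cast; ring
        · rw [hh]; ring
      · refine ⟨1, -1, j, α / 4, ⟨by norm_num, by norm_num, by norm_num, by norm_num,
          by norm_num⟩, by linarith, ?_, ?_, ?_⟩
        · push_cast; ring
        · rw [h1]; push_cast; ring
        · rw [hh]; ring

end ConvexPolygon

/-- `f` is a similarity that multiplies squares of distances by `s`. -/
def IsSimilarity (s : ℝ) (f : Plane → Plane) : Prop :=
  ∀ x y, (f x 0 - f y 0) ^ 2 + (f x 1 - f y 1) ^ 2 = s * ((x 0 - y 0) ^ 2 + (x 1 - y 1) ^ 2)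

theorem IsSimilarity.comp {s t : ℝ} {f g : Plane → Plane} (hf : IsSimilarity s f)
    (hg : IsSimilarity t g) : IsSimilarity (s * t) (f ∘ g) := fun x y => by
  rw [Function.comp_apply, Function.comp_apply, hf, hg, mul_assoc]

theorem IsOctDir.exists_octForm {A B : ℤ} (h : IsOctDir A B) :
    ∃ i, (∀ w, A * w 0 + B * w 1 = octForm i w) ∨ ∀ w, A * w 0 + B * w 1 = -octForm i w := by
  obtain ⟨h1, h2, h3, h4, h5⟩ := h
  have hA : A = -1 ∨ A = 0 ∨ A = 1 := by omega
  have hB : B = -1 ∨ B = 0 ∨ B = 1 := by omega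
  rcases hA with rfl | rfl | rfl <;> rcases hB with rfl | rfl | rfl
  · exact ⟨2, Or.inr fun w => by simp [octForm]; ring⟩
  · exact ⟨0, Or.inr fun w => by simp [octForm]⟩
  · exact ⟨3, Or.inl fun w => by simp [octForm]; ring⟩
  · exact ⟨1, Or.inr fun w => by simp [octForm]⟩
  · simp at h5
  · exact ⟨1, Or.inl fun w => by simp [octForm]⟩
  · exact ⟨3, Or.inr fun w => by simp [octForm]; ring⟩
  · exact ⟨0, Or.inl fun w => by simp [octForm]⟩
  · exact ⟨2, Or.inl fun w => by simp [octForm]⟩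

theorem exists_octForm_eq (i : Fin 4) : ∃ A B : ℤ, ∀ w, octForm i w = A * w 0 + B * w 1 := by
  fin_cases i
  · exact ⟨1, 0, fun w => by simp [octForm]⟩
  · exact ⟨0, 1, fun w => by simp [octForm]⟩
  · exact ⟨1, 1, fun w => by simp [octForm]⟩
  · exact ⟨-1, 1, fun w => by simp [octForm]; ring⟩

/-- In the frame the edge equations have even right-hand sides, so by Cramer's rule a determinant
dividing 2 makes the vertices integral. -/
theorem IsOctDir.det_dvd_two {A B A' B' : ℤ} (h : IsOctDir A B) (h' : IsOctDir A' B')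
    (hD : A * B' - A' * B ≠ 0) : A * B' - A' * B ∣ 2 := by
  obtain ⟨h1, h2, h3, h4, -⟩ := h
  obtain ⟨h1', h2', h3', h4', -⟩ := h'
  obtain ⟨D, hDe⟩ : ∃ D, A * B' - A' * B = D := ⟨_, rfl⟩
  have hb : -2 ≤ D ∧ D ≤ 2 := by
    have hA : A = -1 ∨ A = 0 ∨ A = 1 := by omega
    have hB : B = -1 ∨ B = 0 ∨ B = 1 := by omega
    rcases hA with rfl | rfl | rfl <;> rcases hB with rfl | rfl | rfl <;> omega
  rw [hDe] at hD ⊢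
  obtain ⟨hb1, hb2⟩ := hb
  interval_cases D
  · norm_num
  · norm_num
  · simp at hD
  · norm_num
  · norm_num

namespace ConvexPolygon

variable {Q : ConvexPolygon}
  (hQ : ∀ u h u' h', IsEdgeLine Q.carrier u h → IsEdgeLine Q.carrier u' h' →
    ∀ z ∈ intLattice, reflect u h (reflect u' h' z) ∈ intLattice)

include hQ

/-- Up to a similarity of ratio `√N / 4`, the polygon is an octagon with integer support numbers. -/
theorem exists_isIntOctagon : ∃ N : ℕ, 0 < N ∧ ∃ f, IsSimilarity (N / 16) f ∧
    ∃ a b, IsIntOctagon (f ⁻¹' Q.carrier) a b := by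
  obtain ⟨a, p, q, hN, hedge⟩ := exists_frame hQ
  set N : ℕ := (p ^ 2 + q ^ 2).toNat with hNdef
  have hNR : (N : ℝ) = (p : ℝ) ^ 2 + (q : ℝ) ^ 2 := by
    have : (N : ℤ) = p ^ 2 + q ^ 2 := Int.toNat_of_nonneg hN.le
    exact_mod_cast this
  have hN0 : (0 : ℝ) < (p : ℝ) ^ 2 + (q : ℝ) ^ 2 := by exact_mod_cast hN
  -- The frame vectors are divided by 4, although the vertices are half-integral, so that the edge
  -- equations become `A w₀ + B w₁ = 2 k` with an even constant.
  let f : Plane → Plane := fun w =>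
    !₂[a 0 + w 0 / 4 * p - w 1 / 4 * q, a 1 + w 0 / 4 * q + w 1 / 4 * p]
  have hf0 : ∀ w, f w 0 = a 0 + w 0 / 4 * p - w 1 / 4 * q := fun w => by simp [f]
  have hf1 : ∀ w, f w 1 = a 1 + w 0 / 4 * q + w 1 / 4 * p := fun w => by simp [f]
  have hsurj : ∀ x, ∃ w, f w = x := by
    intro x
    refine ⟨!₂[4 * ((x 0 - a 0) * p + (x 1 - a 1) * q) / (p ^ 2 + q ^ 2),
      4 * (-(x 0 - a 0) * q + (x 1 - a 1) * p) / (p ^ 2 + q ^ 2)], plane_ext ?_ ?_⟩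
    · rw [hf0]
      simp
      field_simp
      ring
    · rw [hf1]
      simp
      field_simp
      ring
  have hline : ∀ u h, IsEdgeLine Q.carrier u h → ∃ A B k : ℤ, ∃ l : ℝ, IsOctDir A B ∧ 0 < l ∧
      dot u !₂[p, q] = 4 * l * A ∧ dot u !₂[-q, p] = 4 * l * B ∧
      ∀ w, dot u (f w) - h = l * (A * w 0 + B * w 1 - 2 * k) := by
    intro u h hu
    obtain ⟨A, B, k, l, hAB, hl, e1, e2, e3⟩ := hedge u h hu
    refine ⟨A, B, k, l, hAB, hl, e1, e2, fun w => ?_⟩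
    rw [e3]
    simp [dot] at e1 e2
    simp only [dot, hf0, hf1]
    linear_combination w 0 / 4 * e1 + w 1 / 4 * e2
  have hint : ∀ w, f w ∈ Q.carrier.extremePoints ℝ → ∃ m n : ℤ, w 0 = m ∧ w 1 = n := by
    intro w hw
    obtain ⟨u, h, u', h', hu, hu', hux, hux', hne⟩ := exists_isEdgeLine_of_extremePoint hQ hw
    obtain ⟨A, B, k, l, hAB, hl, e1, e2, e3⟩ := hline u h hu
    obtain ⟨A', B', k', l', hAB', hl', e1', e2', e3'⟩ := hline u' h' hu'
    have hD : A * B' - A' * B ≠ 0 := by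
      intro h0
      apply hne
      have h0' : (A * B' - A' * B : ℝ) = 0 := by exact_mod_cast h0
      have hc := cross_sq hu.unit hu'.unit
      have h1 : ((p : ℝ) ^ 2 + (q : ℝ) ^ 2) * (u 0 * u' 1 - u 1 * u' 0) = 0 := by
        have h2 : (dot u !₂[(p : ℝ), q]) * dot u' !₂[-(q : ℝ), p] -
            dot u' !₂[(p : ℝ), q] * dot u !₂[-(q : ℝ), p] = 0 := by
          rw [e1, e2, e1', e2']
          linear_combination 16 * l * l' * h0'
        simp [dot] at h2
        linear_combination h2
      have h3 := (mul_eq_zero.1 h1).resolve_left hN0.ne'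
      nlinarith
    obtain ⟨e, he⟩ := hAB.det_dvd_two hAB' hD
    have he' : (2 : ℝ) = (A * B' - A' * B) * e := by exact_mod_cast he
    have h1 : (A * w 0 + B * w 1 - 2 * k : ℝ) = 0 := by
      have := e3 w
      rw [hux, sub_self] at this
      exact (mul_eq_zero.1 this.symm).resolve_left hl.ne'
    have h2 : (A' * w 0 + B' * w 1 - 2 * k' : ℝ) = 0 := by
      have := e3' w
      rw [hux', sub_self] at this
      exact (mul_eq_zero.1 this.symm).resolve_left hl'.ne'
    refine ⟨e * (k * B' - k' * B), e * (k' * A - k * A'), ?_, ?_⟩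
    · push_cast
      linear_combination (w 0 / 2) * he' + e / 2 * (B' * h1 - B * h2)
    · push_cast
      linear_combination (w 1 / 2) * he' + e / 2 * (A * h2 - A' * h1)
  -- A linear form is maximal at a vertex, and the vertices are integral; hence the support numbers
  -- are integers.
  have hmax : ∀ A B : ℤ, ∃ w ∈ f ⁻¹' Q.carrier, ∃ c : ℤ, A * w 0 + B * w 1 = c ∧
      ∀ w' ∈ f ⁻¹' Q.carrier, A * w' 0 + B * w' 1 ≤ (c : ℝ) := by
    intro A B
    obtain ⟨x, hx, hx'⟩ := Q.exists_extremePoint_max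
      !₂[(A * p - B * q : ℝ), A * q + B * p]
    obtain ⟨w, rfl⟩ := hsurj x
    obtain ⟨m, n, hm, hn⟩ := hint w hx
    refine ⟨w, hx.1, A * m + B * n, by rw [hm, hn]; push_cast; ring, fun w' hw' => ?_⟩
    have h := hx' _ hw'
    simp only [dot, hf0, hf1] at h
    simp at h
    push_cast
    rw [← hm, ← hn]
    have h2 : ((p : ℝ) ^ 2 + (q : ℝ) ^ 2) * (A * w' 0 + B * w' 1) ≤
        ((p : ℝ) ^ 2 + (q : ℝ) ^ 2) * (A * w 0 + B * w 1) := by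
      linarith
    exact le_of_mul_le_mul_left h2 hN0
  have hext : ∀ i, ∃ c d : ℤ, (∃ w ∈ f ⁻¹' Q.carrier, octForm i w = c) ∧
      (∃ w ∈ f ⁻¹' Q.carrier, octForm i w = d) ∧
      ∀ w ∈ f ⁻¹' Q.carrier, c ≤ octForm i w ∧ octForm i w ≤ d := by
    intro i
    obtain ⟨A, B, hAB⟩ := exists_octForm_eq i
    simp only [hAB]
    obtain ⟨w, hw, d, hd, hd'⟩ := hmax A B
    obtain ⟨w', hw', c, hc, hc'⟩ := hmax (-A) (-B)
    push_cast at hc hc'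
    refine ⟨-c, d, ⟨w', hw', by push_cast; linarith⟩, ⟨w, hw, hd⟩, fun w hw => ⟨?_, hd' w hw⟩⟩
    have := hc' w hw
    push_cast
    linarith
  choose c d hc hd hcd using hext
  refine ⟨N, by exact_mod_cast hNR ▸ hN0, f, fun x y => ?_, c, d, fun w =>
    ⟨fun hw i => hcd i w hw, fun hw => ?_⟩, hc, hd⟩
  · rw [hNR]
    simp only [hf0, hf1]
    ring
  · by_contra hwQ
    obtain ⟨u, h, hu, huw⟩ := Q.exists_isEdgeLine_lt hwQ
    obtain ⟨A, B, k, l, hAB, hl, -, -, e3⟩ := hline u h hu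
    have h1 : (2 * k : ℝ) < A * w 0 + B * w 1 := by
      have := e3 w
      have : 0 < l * (A * w 0 + B * w 1 - 2 * k) := by linarith
      linarith [pos_of_mul_pos_right this hl.le]
    have h2 : ∀ w' ∈ f ⁻¹' Q.carrier, (A * w' 0 + B * w' 1 : ℝ) ≤ 2 * k := by
      intro w' hw'
      have h3 := hu.le _ hw'
      have := e3 w'
      have : l * (A * w' 0 + B * w' 1 - 2 * k) ≤ l * 0 := by linarith
      linarith [le_of_mul_le_mul_left this hl]
    obtain ⟨i, hi | hi⟩ := hAB.exists_octForm
    · obtain ⟨w', hw', e⟩ := hd i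
      have := h2 w' hw'
      rw [hi] at this h1
      linarith [(hw i).2]
    · obtain ⟨w', hw', e⟩ := hc i
      have := h2 w' hw'
      rw [hi] at this h1
      linarith [(hw i).1]

end ConvexPolygon

/-! ### Normal form of an octagon -/

/-- The octagon with width `D`, height `ω` and corner cuts determined by `c`. -/
def octagon (D ω : ℕ) (c : Fin 4 → ℕ) : Set Plane :=
  {x | (0 ≤ x 0 ∧ x 0 ≤ D) ∧ (0 ≤ x 1 ∧ x 1 ≤ ω) ∧ (c 0 ≤ x 0 + x 1 ∧ x 0 + x 1 ≤ D + c 1) ∧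
    c 2 - D ≤ x 1 - x 0 ∧ x 1 - x 0 ≤ c 3}

namespace IsIntOctagon

variable {S : Set Plane} {a b : Fin 4 → ℤ}

/-- A coordinate change that permutes the linear forms, up to affine maps, preserves octagons. -/
theorem preimage (h : IsIntOctagon S a b) {g : Plane → Plane} (hg : Function.Surjective g)
    {σ : Fin 4 → Fin 4} (hσ : Function.Surjective σ) {r t : Fin 4 → ℝ}
    (hf : ∀ i w, octForm i w = r i * octForm (σ i) (g w) + t i) {a' b' : Fin 4 → ℤ}
    (hr : ∀ i, 0 < r i ∧ a' i = r i * a (σ i) + t i ∧ b' i = r i * b (σ i) + t i ∨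
      r i < 0 ∧ a' i = r i * b (σ i) + t i ∧ b' i = r i * a (σ i) + t i) :
    IsIntOctagon (g ⁻¹' S) a' b' := by
  have key : ∀ i w, (a' i ≤ octForm i w ∧ octForm i w ≤ b' i) ↔
      (a (σ i) ≤ octForm (σ i) (g w) ∧ octForm (σ i) (g w) ≤ b (σ i)) := by
    intro i w
    rw [hf]
    rcases hr i with ⟨h0, e1, e2⟩ | ⟨h0, e1, e2⟩
    · rw [e1, e2, add_le_add_iff_right, add_le_add_iff_right, mul_le_mul_iff_right₀ h0,
        mul_le_mul_iff_right₀ h0]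
    · rw [e1, e2, add_le_add_iff_right, add_le_add_iff_right, mul_le_mul_left_of_neg h0,
        mul_le_mul_left_of_neg h0, and_comm]
  have hleft : ∀ i, ∃ w ∈ g ⁻¹' S, octForm (σ i) (g w) = a (σ i) := by
    intro i
    obtain ⟨x, hx, e⟩ := h.exists_eq_left (σ i)
    obtain ⟨w, rfl⟩ := hg x
    exact ⟨w, hx, e⟩
  have hright : ∀ i, ∃ w ∈ g ⁻¹' S, octForm (σ i) (g w) = b (σ i) := by
    intro i
    obtain ⟨x, hx, e⟩ := h.exists_eq_right (σ i)
    obtain ⟨w, rfl⟩ := hg x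
    exact ⟨w, hx, e⟩
  refine ⟨fun w => ?_, fun i => ?_, fun i => ?_⟩
  · rw [Set.mem_preimage, h.mem_iff]
    simp only [key]
    exact ⟨fun H i => H _, fun H j => by obtain ⟨i, rfl⟩ := hσ j; exact H i⟩
  · rcases hr i with ⟨h0, e1, e2⟩ | ⟨h0, e1, e2⟩
    · obtain ⟨w, hw, e⟩ := hleft i
      exact ⟨w, hw, by rw [hf, e, e1]⟩
    · obtain ⟨w, hw, e⟩ := hright i
      exact ⟨w, hw, by rw [hf, e, e1]⟩
  · rcases hr i with ⟨h0, e1, e2⟩ | ⟨h0, e1, e2⟩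
    · obtain ⟨w, hw, e⟩ := hright i
      exact ⟨w, hw, by rw [hf, e, e2]⟩
    · obtain ⟨w, hw, e⟩ := hleft i
      exact ⟨w, hw, by rw [hf, e, e2]⟩

/-- A turn by 45 degrees with ratio `1/√2` exchanges axis and diagonal forms. The new axis widths
are the old diagonal ones, and the new diagonal widths are twice the old axis ones, so integrality
survives. -/
theorem exists_rotate (h : IsIntOctagon S a b) : ∃ g, IsSimilarity (1 / 2) g ∧
    IsIntOctagon (g ⁻¹' S) ![a 2, a 3, 2 * a 1, -2 * b 0] ![b 2, b 3, 2 * b 1, -2 * a 0] := by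
  refine ⟨fun w => !₂[(w 0 - w 1) / 2, (w 0 + w 1) / 2], fun x y => ?_,
    h.preimage (fun x => ⟨!₂[x 0 + x 1, x 1 - x 0], plane_ext ?_ ?_⟩) (σ := ![2, 3, 1, 0])
      (by decide) (r := ![1, 1, 2, -2]) (t := 0) (fun i w => ?_) fun i => ?_⟩
  · simp; ring
  · simp; ring
  · simp; ring
  · fin_cases i <;> simp [octForm] <;> ring
  · fin_cases i <;> simp

theorem exists_swap (h : IsIntOctagon S a b) : ∃ g, IsSimilarity 1 g ∧
    IsIntOctagon (g ⁻¹' S) ![a 1, a 0, a 2, -b 3] ![b 1, b 0, b 2, -a 3] := by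
  refine ⟨fun w => !₂[w 1, w 0], fun x y => ?_,
    h.preimage (fun x => ⟨!₂[x 1, x 0], plane_ext ?_ ?_⟩) (σ := ![1, 0, 2, 3])
      (by decide) (r := ![1, 1, 1, -1]) (t := 0) (fun i w => ?_) fun i => ?_⟩
  · simp; ring
  · simp
  · simp
  · fin_cases i <;> simp [octForm]
    ring
  · fin_cases i <;> simp

theorem exists_translate (h : IsIntOctagon S a b) : ∃ g, IsSimilarity 1 g ∧
    IsIntOctagon (g ⁻¹' S) ![0, 0, a 2 - a 0 - a 1, a 3 - a 1 + a 0]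
      ![b 0 - a 0, b 1 - a 1, b 2 - a 0 - a 1, b 3 - a 1 + a 0] := by
  refine ⟨fun w => !₂[w 0 + a 0, w 1 + a 1], fun x y => ?_,
    h.preimage (fun x => ⟨!₂[x 0 - a 0, x 1 - a 1], plane_ext ?_ ?_⟩) (σ := id)
      Function.surjective_id (r := 1) (t := ![-a 0, -a 1, -a 0 - a 1, -a 1 + a 0])
      (fun i w => ?_) fun i => ?_⟩
  · simp
  · simp
  · simp
  · fin_cases i <;> simp [octForm] <;> ring
  · fin_cases i <;> simp [sub_eq_add_neg, add_assoc]

/-- Every support number is attained, and the points where this happens confine all four cuts to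
`[0, ω]`. That the bound is the height and not the width matters for the count. -/
theorem exists_eq_octagon_of_left_eq_zero (h : IsIntOctagon S a b) (h0 : a 0 = 0) (h1 : a 1 = 0) :
    ∃ (D ω : ℕ) (c : Fin 4 → ℕ), S = octagon D ω c ∧ b 0 = D ∧ b 1 = ω ∧ a 2 = c 0 ∧
      b 2 = D + c 1 ∧ a 3 = c 2 - D ∧ b 3 = c 3 ∧ ∀ i, c i ≤ ω := by
  have hS : ∀ w ∈ S, (0 ≤ w 0 ∧ w 0 ≤ b 0) ∧ (0 ≤ w 1 ∧ w 1 ≤ b 1) ∧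
      (a 2 ≤ w 0 + w 1 ∧ w 0 + w 1 ≤ b 2) ∧ (a 3 ≤ w 1 - w 0 ∧ w 1 - w 0 ≤ b 3) := by
    intro w hw
    have H := (h.mem_iff w).1 hw
    refine ⟨?_, ?_, H 2, H 3⟩
    · simpa [octForm, h0] using H 0
    · simpa [octForm, h1] using H 1
  obtain ⟨l0, hl0, el0⟩ := h.exists_eq_left 0
  obtain ⟨l2, hl2, el2⟩ := h.exists_eq_left 2
  obtain ⟨l3, hl3, el3⟩ := h.exists_eq_left 3
  obtain ⟨r0, hr0, er0⟩ := h.exists_eq_right 0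
  obtain ⟨r2, hr2, er2⟩ := h.exists_eq_right 2
  obtain ⟨r3, hr3, er3⟩ := h.exists_eq_right 3
  obtain ⟨⟨pl1, pl2⟩, ⟨pl3, pl4⟩, ⟨pl5, pl6⟩, pl7, pl8⟩ := hS _ hl0
  obtain ⟨⟨ql1, ql2⟩, ⟨ql3, ql4⟩, ⟨ql5, ql6⟩, ql7, ql8⟩ := hS _ hl2
  obtain ⟨⟨tl1, tl2⟩, ⟨tl3, tl4⟩, ⟨tl5, tl6⟩, tl7, tl8⟩ := hS _ hl3
  obtain ⟨⟨pr1, pr2⟩, ⟨pr3, pr4⟩, ⟨pr5, pr6⟩, pr7, pr8⟩ := hS _ hr0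
  obtain ⟨⟨qr1, qr2⟩, ⟨qr3, qr4⟩, ⟨qr5, qr6⟩, qr7, qr8⟩ := hS _ hr2
  obtain ⟨⟨tr1, tr2⟩, ⟨tr3, tr4⟩, ⟨tr5, tr6⟩, tr7, tr8⟩ := hS _ hr3
  simp only [octForm, h0, Int.cast_zero] at el0 el2 el3 er0 er2 er3
  have i1 : 0 ≤ b 0 := by exact_mod_cast (by linarith : (0 : ℝ) ≤ b 0)
  have i2 : 0 ≤ b 1 := by exact_mod_cast (by linarith : (0 : ℝ) ≤ b 1)
  have i3 : 0 ≤ a 2 := by exact_mod_cast (by linarith : (0 : ℝ) ≤ a 2)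
  have i4 : a 2 ≤ b 1 := by exact_mod_cast (by linarith : (a 2 : ℝ) ≤ b 1)
  have i5 : b 0 ≤ b 2 := by exact_mod_cast (by linarith : (b 0 : ℝ) ≤ b 2)
  have i6 : b 2 ≤ b 0 + b 1 := by exact_mod_cast (by linarith : (b 2 : ℝ) ≤ b 0 + b 1)
  have i7 : -b 0 ≤ a 3 := by exact_mod_cast (by linarith : (-b 0 : ℝ) ≤ a 3)
  have i8 : a 3 ≤ b 1 - b 0 := by exact_mod_cast (by linarith : (a 3 : ℝ) ≤ b 1 - b 0)
  have i9 : 0 ≤ b 3 := by exact_mod_cast (by linarith : (0 : ℝ) ≤ b 3)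
  have i10 : b 3 ≤ b 1 := by exact_mod_cast (by linarith : (b 3 : ℝ) ≤ b 1)
  obtain ⟨D, hD⟩ := Int.eq_ofNat_of_zero_le i1
  obtain ⟨ω, hω⟩ := Int.eq_ofNat_of_zero_le i2
  obtain ⟨c0, hc0⟩ := Int.eq_ofNat_of_zero_le i3
  obtain ⟨c1, hc1⟩ := Int.eq_ofNat_of_zero_le (sub_nonneg.2 i5)
  obtain ⟨c2, hc2⟩ := Int.eq_ofNat_of_zero_le (by omega : 0 ≤ a 3 + b 0)
  obtain ⟨c3, hc3⟩ := Int.eq_ofNat_of_zero_le i9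
  have e2 : b 2 = D + c1 := by omega
  have e3 : a 3 = c2 - D := by omega
  refine ⟨D, ω, ![c0, c1, c2, c3], ?_, hD, hω, hc0, e2, e3, hc3, fun i => ?_⟩
  · ext w
    rw [h.mem_iff, Fin.forall_fin_succ, Fin.forall_fin_succ, Fin.forall_fin_two]
    simp [octForm, octagon, h0, h1, hD, hω, hc0, e2, e3, hc3]
  · fin_cases i <;> simp <;> omega

theorem exists_eq_octagon_of_le (h : IsIntOctagon S a b) (hle : b 1 - a 1 ≤ b 0 - a 0)
    (h2 : 7 * (b 1 - a 1) ≤ 5 * (b 2 - a 2)) (h3 : 7 * (b 1 - a 1) ≤ 5 * (b 3 - a 3)) :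
    ∃ g, IsSimilarity 1 g ∧ ∃ (D ω : ℕ) (c : Fin 4 → ℕ), g ⁻¹' S = octagon D ω c ∧ ω ≤ D ∧
      (∀ i, c i ≤ ω) ∧ 7 * ω + 5 * c 0 ≤ 5 * (D + c 1) ∧ 7 * ω + 5 * c 2 ≤ 5 * (D + c 3) := by
  obtain ⟨g, hg, hO⟩ := h.exists_translate
  obtain ⟨D, ω, c, hc, e⟩ := hO.exists_eq_octagon_of_left_eq_zero rfl rfl
  simp at e
  obtain ⟨e1, e2, e3, e4, e5, e6, e7⟩ := e
  exact ⟨g, hg, D, ω, c, hc, by omega, e7, by omega, by omega⟩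

theorem exists_eq_octagon_of_min_le (h : IsIntOctagon S a b)
    (h2 : 7 * min (b 0 - a 0) (b 1 - a 1) ≤ 5 * (b 2 - a 2))
    (h3 : 7 * min (b 0 - a 0) (b 1 - a 1) ≤ 5 * (b 3 - a 3)) :
    ∃ g, IsSimilarity 1 g ∧ ∃ (D ω : ℕ) (c : Fin 4 → ℕ), g ⁻¹' S = octagon D ω c ∧ ω ≤ D ∧
      (∀ i, c i ≤ ω) ∧ 7 * ω + 5 * c 0 ≤ 5 * (D + c 1) ∧ 7 * ω + 5 * c 2 ≤ 5 * (D + c 3) := by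
  rcases le_total (b 1 - a 1) (b 0 - a 0) with hle | hle
  · rw [min_eq_right hle] at h2 h3
    exact h.exists_eq_octagon_of_le hle h2 h3
  · rw [min_eq_left hle] at h2 h3
    obtain ⟨g, hg, hO⟩ := h.exists_swap
    obtain ⟨g', hg', H⟩ := hO.exists_eq_octagon_of_le (by simpa using hle) (by simpa using h2)
      (by simpa [add_comm, ← sub_eq_add_neg] using h3)
    exact ⟨g ∘ g', by simpa using hg.comp hg', H⟩

/-- In a suitable frame an octagon has a large part of its bounding box. -/
theorem exists_eq_octagon (h : IsIntOctagon S a b) :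
    ∃ s g, (s = 1 ∨ s = 1 / 2) ∧ IsSimilarity s g ∧ ∃ (D ω : ℕ) (c : Fin 4 → ℕ),
      g ⁻¹' S = octagon D ω c ∧ ω ≤ D ∧
      (∀ i, c i ≤ ω) ∧ 7 * ω + 5 * c 0 ≤ 5 * (D + c 1) ∧ 7 * ω + 5 * c 2 ≤ 5 * (D + c 3) := by
  by_cases hcase : 7 * min (b 0 - a 0) (b 1 - a 1) ≤ 5 * min (b 2 - a 2) (b 3 - a 3)
  · obtain ⟨g, hg, H⟩ := h.exists_eq_octagon_of_min_le (by omega) (by omega)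
    exact ⟨1, g, Or.inl rfl, hg, H⟩
  -- If the frame fails the test with the constant 7/5, the rotated one passes it: this needs `7² ≤
  -- 2 * 5²`, that is, 7/5 is below `√2`.
  · obtain ⟨g, hg, hO⟩ := h.exists_rotate
    have w0 : a 0 ≤ b 0 := by
      obtain ⟨w, hw, e⟩ := h.exists_eq_left 0
      exact_mod_cast e ▸ ((h.mem_iff w).1 hw 0).2
    have w1 : a 1 ≤ b 1 := by
      obtain ⟨w, hw, e⟩ := h.exists_eq_left 1
      exact_mod_cast e ▸ ((h.mem_iff w).1 hw 1).2
    obtain ⟨g', hg', H⟩ := hO.exists_eq_octagon_of_min_le (by simp; omega) (by simp; omega)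
    exact ⟨1 / 2, g ∘ g', Or.inr rfl, by simpa using hg.comp hg', H⟩

end IsIntOctagon

/-! ### Area of the normal form -/

/-- The box with the centre of the bounding box and a tenth of its size fits inside: the lower
bounds on the diagonal widths keep the cuts away from the centre. -/
theorem le_volume_octagon {D ω : ℕ} {c : Fin 4 → ℕ} (hD : ω ≤ D) (hc : ∀ i, c i ≤ ω)
    (h1 : 7 * ω + 5 * c 0 ≤ 5 * (D + c 1)) (h2 : 7 * ω + 5 * c 2 ≤ 5 * (D + c 3)) :
    ENNReal.ofReal (D * ω / 100) ≤ volume (octagon D ω c) := by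
  let l : Fin 2 → ℝ := ![9 / 20 * D, 9 / 20 * ω]
  let u : Fin 2 → ℝ := ![11 / 20 * D, 11 / 20 * ω]
  have hsub : WithLp.ofLp ⁻¹' Set.Icc l u ⊆ octagon D ω c := by
    intro x hx
    simp [Set.mem_Icc, Pi.le_def, Fin.forall_fin_two, l, u] at hx
    obtain ⟨⟨x1, x2⟩, x3, x4⟩ := hx
    have g0 : (c 0 : ℝ) ≤ ω := by exact_mod_cast hc 0
    have g1 : (c 1 : ℝ) ≤ ω := by exact_mod_cast hc 1
    have g2 : (c 2 : ℝ) ≤ ω := by exact_mod_cast hc 2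
    have g3 : (c 3 : ℝ) ≤ ω := by exact_mod_cast hc 3
    have g4 : (0 : ℝ) ≤ c 1 := by positivity
    have g5 : (0 : ℝ) ≤ c 3 := by positivity
    have g6 : (ω : ℝ) ≤ D := by exact_mod_cast hD
    have g7 : (0 : ℝ) ≤ ω := by positivity
    have g8 : (7 * ω + 5 * c 0 : ℝ) ≤ 5 * (D + c 1) := by exact_mod_cast h1
    have g9 : (7 * ω + 5 * c 2 : ℝ) ≤ 5 * (D + c 3) := by exact_mod_cast h2
    refine ⟨⟨?_, ?_⟩, ⟨?_, ?_⟩, ⟨?_, ?_⟩, ?_, ?_⟩ <;> linarith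
  refine le_trans (le_of_eq ?_) (measure_mono hsub)
  rw [(PiLp.volume_preserving_ofLp (Fin 2)).measure_preimage measurableSet_Icc.nullMeasurableSet,
    Real.volume_Icc_pi, Fin.prod_univ_two, ← ENNReal.ofReal_mul]
  · congr 1
    simp [l, u]
    ring
  · simp [l, u]
    linarith [(Nat.cast_nonneg D : (0 : ℝ) ≤ D)]

namespace ConvexPolygon

open scoped Pointwise

/-- Composed with a dilation by `1/√s`, the similarity becomes an isometry of the plane. -/
theorem exists_congruent_smul_preimage (P : ConvexPolygon) {s : ℝ} (hs : 0 < s) {f : Plane → Plane}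
    (hf : IsSimilarity s f) :
    ∃ Q, congruence P Q ∧ Q.carrier = √s • (f ⁻¹' P.carrier) := by
  have h0 : √s ≠ 0 := (Real.sqrt_pos.2 hs).ne'
  have hiso : Isometry fun x => f ((√s)⁻¹ • x) := by
    refine isometry_of_sq fun x y => ?_
    rw [hf]
    have h1 : s * (√s)⁻¹ ^ 2 = 1 := by
      rw [inv_pow, Real.sq_sqrt hs.le, mul_inv_cancel₀ hs.ne']
    simp
    linear_combination ((x 0 - y 0) ^ 2 + (x 1 - y 1) ^ 2) * h1
  obtain ⟨τ, hτ⟩ := exists_affineIsometryEquiv (A := Set.univ) (by simp)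
    (fun x _ y _ => hiso.edist_eq x y)
  refine ⟨P.map τ.symm, P.congruence_map _, ?_⟩
  ext x
  rw [Set.mem_smul_set_iff_inv_smul_mem₀ h0, Set.mem_preimage, hτ x trivial]
  refine ⟨?_, fun hx => ⟨_, hx, τ.symm_apply_apply x⟩⟩
  rintro ⟨y, hy, rfl⟩
  rwa [τ.apply_symm_apply]

theorem GluableFrom.exists_congruent_octagon {P : ConvexPolygon} {m : ℕ} (h : P.GluableFrom m) :
    ∃ Q, congruence P Q ∧ ∃ (j D ω : ℕ) (c : Fin 4 → ℕ), Q.carrier = √(j / 32) • octagon D ω c ∧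
      0 < j ∧ 0 < ω ∧ ω ≤ D ∧ (∀ i, c i ≤ ω) ∧ j * ω * D ≤ 3200 * m := by
  obtain ⟨Q, hPQ, hvol, hQ⟩ := h.exists_congruent
  obtain ⟨N, hN, f, hf, a, b, hO⟩ := exists_isIntOctagon hQ
  obtain ⟨s, g, hs, hg, D, ω, c, hgO, hωD, hc, h1, h2⟩ := hO.exists_eq_octagon
  -- Without the turn the squared ratio is `2 N / 32`, with it `N / 32`.
  obtain ⟨j, hj, hjs⟩ : ∃ j : ℕ, 0 < j ∧ (N / 16 : ℝ) * s = j / 32 := by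
    rcases hs with rfl | rfl
    · exact ⟨2 * N, by omega, by push_cast; ring⟩
    · exact ⟨N, hN, by ring⟩
  have hfg := hf.comp hg
  rw [hjs] at hfg
  have hj0 : (0 : ℝ) < j / 32 := by positivity
  obtain ⟨R, hQR, hR⟩ := Q.exists_congruent_smul_preimage hj0 hfg
  rw [Set.preimage_comp, hgO] at hR
  have hvolR : volume R.carrier ≤ m := by
    obtain ⟨e, he⟩ := hQR
    rw [← he, show e '' Q.carrier = e.toRealAffineIsometryEquiv '' Q.carrier by
      rw [IsometryEquiv.coeFn_toRealAffineIsometryEquiv], volume_image_affineIsometryEquiv]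
    exact hvol
  refine ⟨R, congruence.trans hPQ hQR, j, D, ω, c, hR, hj, ?_, hωD, hc, ?_⟩
  -- Height 0 would make the polygon flat.
  · rw [Nat.pos_iff_ne_zero]
    intro hω
    obtain ⟨x, hx⟩ := R.nonempty_interior
    have hz : ∀ y ∈ R.carrier, y 1 = 0 := by
      intro y hy
      rw [hR] at hy
      obtain ⟨z, hz, rfl⟩ := hy
      obtain ⟨-, ⟨hz1, hz2⟩, -⟩ := hz
      rw [hω] at hz2
      simp [le_antisymm (by simpa using hz2) hz1]
    have h1 := dot_lt_of_mem_interior (u := !₂[0, 1]) (h := 0) (by simp [dot])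
      (fun y hy => by simp [dot, hz y hy]) hx
    simp [dot, hz x (interior_subset hx)] at h1
  -- The area is at least `(j / 32) * (D * ω / 100)`, whence `3200 = 32 * 100`.
  · rw [hR, Measure.addHaar_smul] at hvolR
    have h3 := (mul_le_mul_right (le_volume_octagon hωD hc h1 h2) _).trans hvolR
    rw [← ENNReal.ofReal_mul (abs_nonneg _), ← ENNReal.ofReal_natCast,
      ENNReal.ofReal_le_ofReal_iff (by positivity)] at h3
    rw [finrank_euclideanSpace_fin, Real.sq_sqrt hj0.le, abs_of_pos hj0] at h3
    have h4 : (j * ω * D : ℝ) ≤ 3200 * m := by linarith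
    exact_mod_cast h4

end ConvexPolygon

/-! ### Counting -/

/-- The numbers `(j, ω, D, c)` with `j ω D ≤ K`, `ω ≤ D` and `c i ≤ ω`. -/
def octagonData (K : ℕ) : Finset (Σ _ : ℕ, Σ _ : ℕ, ℕ × (Fin 4 → ℕ)) :=
  (Finset.Icc 1 K).sigma fun j => (Finset.Icc 1 (K / j).sqrt).sigma fun ω =>
    Finset.Icc 1 (K / j / ω) ×ˢ Fintype.piFinset fun _ : Fin 4 => Finset.range (ω + 1)

theorem mem_octagonData {K j D ω : ℕ} {c : Fin 4 → ℕ} (hj : 0 < j) (hω : 0 < ω) (hD : ω ≤ D)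
    (hc : ∀ i, c i ≤ ω) (hK : j * ω * D ≤ K) : ⟨j, ω, D, c⟩ ∈ octagonData K := by
  have h1 : D * ω ≤ K / j := by
    rw [Nat.le_div_iff_mul_le hj]
    linarith
  simp only [octagonData, Finset.mem_sigma, Finset.mem_Icc, Finset.mem_product,
    Fintype.mem_piFinset, Finset.mem_range]
  refine ⟨⟨hj, ?_⟩, ⟨hω, ?_⟩, ⟨hω.trans_le hD, ?_⟩, fun i => Nat.lt_succ_of_le (hc i)⟩
  · refine le_trans ?_ hK
    rw [mul_assoc]
    exact Nat.le_mul_of_pos_right _ (Nat.mul_pos hω (hω.trans_le hD))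
  · rw [Nat.le_sqrt]
    exact (Nat.mul_le_mul_right _ hD).trans h1
  · rwa [Nat.le_div_iff_mul_le hω]

/-- For each `ω ≤ √M` there are `M / ω` widths and `(ω + 1)⁴ ≤ 16 ω⁴` cuts, so at most `16 M √M³`;
summing over `ω` contributes one more factor `√M`. -/
theorem card_octagonData_le (K : ℕ) :
    (octagonData K).card ≤ ∑ j ∈ Finset.Icc 1 K, 16 * (K / j) ^ 3 := by
  rw [octagonData, Finset.card_sigma]
  refine Finset.sum_le_sum fun j _ => ?_
  rw [Finset.card_sigma]
  set M := K / j
  have hr : M.sqrt * M.sqrt ≤ M := Nat.sqrt_le M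
  calc ∑ ω ∈ Finset.Icc 1 M.sqrt,
        (Finset.Icc 1 (M / ω) ×ˢ Fintype.piFinset fun _ : Fin 4 => Finset.range (ω + 1)).card
      ≤ ∑ ω ∈ Finset.Icc 1 M.sqrt, 16 * M * M.sqrt ^ 3 := by
        refine Finset.sum_le_sum fun ω hω => ?_
        obtain ⟨h1, h2⟩ := Finset.mem_Icc.1 hω
        rw [Finset.card_product, Fintype.card_piFinset]
        simp only [Nat.card_Icc, Finset.card_range, Finset.prod_const, Finset.card_univ,
          Fintype.card_fin, Nat.add_sub_cancel]
        calc M / ω * (ω + 1) ^ 4 ≤ M / ω * (2 * ω) ^ 4 := by gcongr; omega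
          _ = 16 * (M / ω * ω) * ω ^ 3 := by ring
          _ ≤ 16 * M * M.sqrt ^ 3 := by gcongr; exact Nat.div_mul_le_self M ω
    _ = 16 * M * (M.sqrt * M.sqrt) * (M.sqrt * M.sqrt) := by
        rw [Finset.sum_const, Nat.card_Icc, Nat.add_sub_cancel, smul_eq_mul]
        ring
    _ ≤ 16 * M * M * M := by gcongr
    _ = 16 * M ^ 3 := by ring

/-- Summing over the scale `j` costs only the constant `∑ j⁻³`, whose term at 0 vanishes by the
convention for inverses. -/
theorem card_octagonData_le_tsum (K : ℕ) :
    ((octagonData K).card : ℝ) ≤ 16 * (∑' j : ℕ, ((j : ℝ) ^ 3)⁻¹) * K ^ 3 := by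
  have hs : Summable fun j : ℕ => ((j : ℝ) ^ 3)⁻¹ := Real.summable_nat_pow_inv.2 (by norm_num)
  calc ((octagonData K).card : ℝ)
      ≤ ((∑ j ∈ Finset.Icc 1 K, 16 * (K / j) ^ 3 : ℕ) : ℝ) := by
        exact_mod_cast card_octagonData_le K
    _ ≤ ∑ j ∈ Finset.Icc 1 K, 16 * K ^ 3 * ((j : ℝ) ^ 3)⁻¹ := by
        push_cast
        refine Finset.sum_le_sum fun j _ => ?_
        calc (16 * ((K / j : ℕ) : ℝ) ^ 3) ≤ 16 * (K / j : ℝ) ^ 3 := by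
              gcongr
              exact Nat.cast_div_le
          _ = 16 * K ^ 3 * ((j : ℝ) ^ 3)⁻¹ := by ring
    _ = 16 * K ^ 3 * ∑ j ∈ Finset.Icc 1 K, ((j : ℝ) ^ 3)⁻¹ := by rw [Finset.mul_sum]
    _ ≤ 16 * K ^ 3 * ∑' j : ℕ, ((j : ℝ) ^ 3)⁻¹ := by
        gcongr
        exact hs.sum_le_tsum _ fun j _ => by positivity
    _ = 16 * (∑' j : ℕ, ((j : ℝ) ^ 3)⁻¹) * K ^ 3 := by ring

open scoped Pointwise in
-- The numbers determine the normalized polygon itself, so any choice of numbers for each class is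
-- injective.
theorem ConvexPolygon.exists_injOn_gluableClasses (n : ℕ) :
    ∃ f : Quotient congruence → Σ _ : ℕ, Σ _ : ℕ, ℕ × (Fin 4 → ℕ),
      Set.MapsTo f (gluableClasses n) (octagonData (3200 * n)) ∧
      Set.InjOn f (gluableClasses n) := by
  have H : ∀ x ∈ gluableClasses n, ∃ t ∈ octagonData (3200 * n), ∃ Q : ConvexPolygon,
      Quotient.mk congruence Q = x ∧
      Q.carrier = √(t.1 / 32) • octagon t.2.2.1 t.2.1 t.2.2.2 := by
    rintro _ ⟨P, rfl, m, hm, hP⟩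
    obtain ⟨Q, hPQ, j, D, ω, c, hQ, hj, hω, hD, hc, hK⟩ := hP.exists_congruent_octagon
    exact ⟨⟨j, ω, D, c⟩, mem_octagonData hj hω hD hc (hK.trans (Nat.mul_le_mul_left _ hm)), Q,
      (Quotient.sound hPQ).symm, hQ⟩
  choose! f hf Q hQ hc using H
  refine ⟨f, hf, fun x hx y hy hxy => ?_⟩
  rw [← hQ x hx, ← hQ y hy]
  refine Quotient.sound ⟨IsometryEquiv.refl _, ?_⟩
  rw [hc x hx, hc y hy, hxy]
  exact Set.image_id _

theorem theorem5 :
    ∃ C : ℝ, ∀ n : ℕ, (ConvexPolygon.gluableClasses n).Finite ∧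
      ((ConvexPolygon.gluableClasses n).ncard : ℝ) ≤ C * (n : ℝ) ^ 3 := by
  refine ⟨16 * (∑' j : ℕ, ((j : ℝ) ^ 3)⁻¹) * 3200 ^ 3, fun n => ?_⟩
  obtain ⟨f, hf, hinj⟩ := ConvexPolygon.exists_injOn_gluableClasses n
  have hfin := (octagonData (3200 * n)).finite_toSet
  refine ⟨Set.Finite.of_injOn hf hinj hfin, ?_⟩
  have h1 := Set.ncard_le_ncard_of_injOn f hf hinj hfin
  rw [Set.ncard_coe_finset] at h1
  calc ((ConvexPolygon.gluableClasses n).ncard : ℝ) ≤ (octagonData (3200 * n)).card := by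
        exact_mod_cast h1
    _ ≤ _ := card_octagonData_le_tsum _
    _ = _ := by push_cast; ring
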